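/- **Model.** A *future-parallel computation* is a finite directed acyclic graph whose nodes are tasks and whose edges are continuation, future and touch edges. A *thread* is a maximal chain of continuation edges; the main thread goes from the root (the only node of in-degree $0$) to the final node (the only node of out-degree $0$). Every other thread $t$ (a *future thread*) starts at the target of a future edge leaving a node $v$ of another thread, the *fork* of $t$; the other outgoing edge of $v$ is a continuation edge to the *right child* of $v$, and both children of $v$ have in-degree $1$. A touch edge goes from a node of a future thread $t$ to a node $x$ of another thread; $x$ is then a *touch* of $t$, and the predecessor of $x$ in its own thread is the *local parent* of $x$. The last node of each future thread has an outgoing touch edge. A touch other than the final node has in-degree $2$; the final node may receive any number of touch edges, each from the last node of a future thread. The computation is *structured single-touch with a super final node* if every future thread, with fork $v$, has at least one touch, at most one of its touches is different from the final node, and such a touch is a descendant of the right child of $v$, its local parent being a descendant of $v$. The span $T_\infty$ is the length of a longest directed path. *Work stealing.* $P\ge 1$ processors each have a deque; at first one processor holds the root. At each step one processor acts. If it holds a node, it executes it and then continues with a ready child, if there is one: at a fork with the future thread, pushing the right child onto the bottom of its deque; at a node that makes both the next node of its own thread and a touch of its thread ready, with the former, pushing the latter. If no child is ready, it pops the bottom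 of its deque if it is not empty. If the acting processor holds no node, it chooses a victim uniformly at random among the $P$ processors, independently of the past, and steals the top node of the victim's deque if there is one. An adaptive adversary who knows the past, but not the coming random choice, chooses the acting processor, subject to the yield rule with parameter $b\in\mathbb N$: in every period in which some processor makes more than $b$ steal attempts, every processor acts at least once. (For $b=1$, no processor makes a second steal attempt until every processor has acted since its previous one; processors working in rounds in which each acts once, in any order, satisfy the rule with $b=2$.) The *sequential execution* is the one with $P=1$. A node $v_2$ whose immediate predecessor in the sequential execution is $v_1$ is a *deviation* of a parallel execution if no processor executes $v_2$ immediately after $v_1$. Each task performs a finite sequence of accesses to memory blocks; each processor has its own fully associative, initially empty LRU cache with $C$ lines. The *additional cache misses* are the excess (if positive) of the total number of misses of the parallel execution over that of the sequential one. **Theorem.** For every $b$ there is a constant $K$ such that for every structured single-touch computation with a super final node, every $P\ge1$, every adversary obeying the yield rule with parameter $b$, every assignment of sequences of memory accesses to the tasks and every $C$, the future-first parallel execution with work stealing incurs at most $K P T_\infty^2$ deviations and at most $K C P T_\infty^2$ additional cache misses in expectation. -/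

import Mathlib

/-!
Future-parallel computation DAGs whose final node may be a super final node, parsimonious
future-first work stealing with uniformly random victims, deviations, and LRU cache misses.
-/

open scoped ENNReal

/-- A future-parallel computation DAG. `cont u` is the target of the continuation edge leaving `u`,
`spawn u` is the target of the future edge leaving `u` (so `u` is a fork iff `spawn u ≠ none`), and
`touch u x` says that there is a touch edge from `u` to `x`. The maximal chains of continuation
edges are the threads; the main thread goes from `root` to `final`, and every other thread starts at
the target of a future edge. The node `final` may receive touch edges from any number of threads;
every other node has in-degree at most two. -/
structure FutureDag (V : Type*) where
  cont : V → Option V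
  spawn : V → Option V
  touch : V → V → Prop
  root : V
  final : V
  /-- There is no directed cycle. -/
  acyclic : ∀ v, ¬ Relation.TransGen
    (fun a b => cont a = some b ∨ spawn a = some b ∨ touch a b) v v
  /-- A node has at most one incoming continuation edge. -/
  cont_inj : ∀ {a a' b}, cont a = some b → cont a' = some b → a = a'
  /-- A node has at most one incoming future edge. -/
  spawn_inj : ∀ {a a' b}, spawn a = some b → spawn a' = some b → a = a'
  /-- The target of a future edge is the first node of its thread. -/
  spawn_first : ∀ {a b}, spawn a = some b → ∀ c, cont c ≠ some b
  /-- The root has in-degree zero. -/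
  root_source : ∀ a, cont a ≠ some root ∧ spawn a ≠ some root ∧ ¬ touch a root
  /-- The first node of every thread other than the main thread is the target of a future edge. -/
  has_parent : ∀ v, v ≠ root → (∃ a, cont a = some v) ∨ (∃ a, spawn a = some v)
  /-- The main thread ends at the final node. -/
  main_thread : Relation.ReflTransGen (fun a b => cont a = some b) root final
  /-- The final node has out-degree zero. -/
  final_sink : cont final = none ∧ spawn final = none ∧ ∀ x, ¬ touch final x
  /-- The last node of every other thread has an outgoing touch edge. -/
  last_touch : ∀ u, cont u = none → u ≠ final → ∃ x, touch u x
  /-- A fork has a continuation edge. -/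
  fork_cont : ∀ {v f}, spawn v = some f → ∃ r, cont v = some r
  /-- A fork has no outgoing touch edge, so its out-degree is two. -/
  fork_no_touch : ∀ {v f}, spawn v = some f → ∀ x, ¬ touch v x
  /-- The children of a fork are not touches, so they have in-degree one. -/
  fork_children : ∀ {v f}, spawn v = some f → ∀ u,
    ¬ touch u f ∧ ∀ r, cont v = some r → ¬ touch u r
  /-- The source of a touch edge lies in a future thread, and its target in another thread. -/
  touch_source : ∀ {u x}, touch u x → ∃ v f, spawn v = some f ∧
    Relation.ReflTransGen (fun a b => cont a = some b) f u ∧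
    ¬ Relation.ReflTransGen (fun a b => cont a = some b) f x
  /-- A touch has a local parent. -/
  touch_local : ∀ {u x}, touch u x → ∃ p, cont p = some x
  /-- A touch other than the final node has only one future parent. -/
  touch_unique : ∀ {u u' x}, touch u x → touch u' x → x ≠ final → u = u'
  /-- Touch edges into the final node start at last nodes of threads. -/
  touch_final : ∀ {u}, touch u final → cont u = none

namespace FutureDag

variable {V : Type*} (G : FutureDag V)

/-- There is an edge, of one of the three kinds, from `a` to `b`. -/
def Edge (a b : V) : Prop := G.cont a = some b ∨ G.spawn a = some b ∨ G.touch a b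

/-- `b` is a descendant of `a` (or `a` itself). -/
def Reaches (a b : V) : Prop := Relation.ReflTransGen G.Edge a b

/-- For the first node `f` of a thread: `u` lies in that thread. -/
def InThread (f u : V) : Prop := Relation.ReflTransGen (fun a b => G.cont a = some b) f u

/-- For the first node `f` of a future thread: `x` is a touch of that thread. -/
def IsTouchOf (f x : V) : Prop := ∃ u, G.InThread f u ∧ G.touch u x

/-- Structured single-touch computations with a super final node: the future thread spawned at a
fork `v` with right child `r` has at least one touch, at most one of its touches is different from
the final node, and such a touch is a descendant of `r`, its local parent being a descendant
of `v`. -/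
def IsSuperFinalSingleTouch : Prop :=
  ∀ v f r, G.spawn v = some f → G.cont v = some r →
    (∃ x, G.IsTouchOf f x) ∧
    (∀ x y, G.IsTouchOf f x → G.IsTouchOf f y → x ≠ G.final → y ≠ G.final → x = y) ∧
    (∀ x, G.IsTouchOf f x → x ≠ G.final →
      G.Reaches r x ∧ ∀ p, G.cont p = some x → G.Reaches v p)

/-- The computation span: the number of edges of a longest directed path. -/
noncomputable def span : ℕ := sSup {n | ∃ l : List V, l.IsChain G.Edge ∧ l.length = n + 1}

end FutureDag

/-- A state of an execution by `P` processors. `cur p` is the node that processor `p` is going to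
execute, `dq p` is its deque (the head of the list is the bottom), and `log` lists the nodes executed
so far with the processors that executed them, most recent first. -/
structure WSState (V : Type*) (P : ℕ) where
  cur : Fin P → Option V
  dq : Fin P → List V
  log : List (Fin P × V)

/-- The nodes executed by processor `p`, in order. -/
def procOrder {V : Type*} {P : ℕ} (log : List (Fin P × V)) (p : Fin P) : List V :=
  ((log.filter (fun e => e.1 = p)).map Prod.snd).reverse

/-- Node `v` has been executed. -/
def Executed {V : Type*} {P : ℕ} (log : List (Fin P × V)) (v : V) : Prop :=
  v ∈ log.map Prod.snd

namespace FutureDag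

section Scheduler

variable {V : Type*} [Fintype V] (G : FutureDag V) {P : ℕ}

open scoped Classical in
/-- The children of `a` that are ready (all their parents have been executed), in the order in which
a processor that has just executed `a` prefers them: the first node of the future thread, the next
node of the thread of `a`, touches of the thread of `a`. -/
noncomputable def enabled (log : List (Fin P × V)) (a : V) : List V :=
  ((G.spawn a).toList ++ (G.cont a).toList ++ (Finset.univ.filter (G.touch a)).toList).filter
    (fun c => ∀ d, G.Edge d c → Executed log d)

/-- Processor `p` executes `a`. It continues with the first enabled child and pushes the others
onto the bottom of its deque (at a fork: it continues with the future thread and pushes the right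
child); if no child is enabled, it pops the bottom of its deque. -/
noncomputable def execute (s : WSState V P) (p : Fin P) (a : V) : WSState V P :=
  let log := (p, a) :: s.log
  let l := G.enabled log a ++ s.dq p
  { cur := Function.update s.cur p l.head?
    dq := Function.update s.dq p l.tail
    log := log }

/-- Processor `p` tries to steal the top node of the deque of `q`; nothing happens if that deque is
empty. -/
def _root_.WSState.steal (s : WSState V P) (p q : Fin P) : WSState V P :=
  match (s.dq q).getLast? with
  | none => s
  | some c =>
    { cur := Function.update s.cur p (some c)
      dq := Function.update s.dq q (s.dq q).dropLast
      log := s.log }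

/-- One step of processor `p`: if it has a node, it executes it, and otherwise it makes a steal
attempt on the victim `q`. -/
noncomputable def step (s : WSState V P) (p q : Fin P) : WSState V P :=
  match s.cur p with
  | some a => G.execute s p a
  | none => s.steal p q

/-- Initially processor `p₀` holds the root, and all deques are empty. -/
def init (p₀ : Fin P) : WSState V P :=
  { cur := fun p => if p = p₀ then some G.root else none
    dq := fun _ => []
    log := [] }

end Scheduler

end FutureDag

/-- An adaptive adversary chooses the processor that takes step `n`, knowing the random victims
drawn at the previous steps (and hence the whole history), but not the one drawn at step `n`. -/
def Adversary (P : ℕ) : Type := (n : ℕ) → (Fin n → Fin P) → Fin P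

/-- The processor scheduled at step `n`, if the victims are drawn according to `x`. -/
def Adversary.sched {P : ℕ} (σ : Adversary P) (x : ℕ → Fin P) (n : ℕ) : Fin P :=
  σ n (fun i => x i)

namespace FutureDag

section Runs

variable {V : Type*} [Fintype V] (G : FutureDag V) {P : ℕ}

/-- The state after `n` steps; `x n` is the victim if step `n` is a steal attempt. -/
noncomputable def run (p₀ : Fin P) (σ : Adversary P) (x : ℕ → Fin P) : ℕ → WSState V P
  | 0 => G.init p₀
  | n + 1 => G.step (run p₀ σ x n) (σ.sched x n) (x n)

/-- Step `n` is a steal attempt by processor `p`. -/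
def StealAttempt (p₀ : Fin P) (σ : Adversary P) (x : ℕ → Fin P) (p : Fin P) (n : ℕ) : Prop :=
  σ.sched x n = p ∧ (G.run p₀ σ x n).cur p = none

open scoped Classical in
/-- The adversary respects yields with parameter `b`: in every period in which some processor makes
more than `b` steal attempts, every processor takes at least one step. -/
def YieldFair (b : ℕ) (p₀ : Fin P) (σ : Adversary P) : Prop :=
  ∀ (x : ℕ → Fin P) (m n : ℕ) (p : Fin P),
    b < ((Finset.Ico m n).filter (G.StealAttempt p₀ σ x p)).card →
    ∀ q, ∃ k ∈ Finset.Ico m n, σ.sched x k = q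

/-- The order in which the nodes are executed by a single processor. -/
noncomputable def seqOrder : List V :=
  procOrder (G.run (P := 1) 0 (fun _ _ => 0) (fun _ => 0) (Fintype.card V)).log 0

/-- `v` has been executed and is a deviation: in the sequential execution it comes immediately after
some node `a`, but no processor executed it immediately after `a`. -/
def IsDeviation (log : List (Fin P × V)) (v : V) : Prop :=
  Executed log v ∧ ∃ a, [a, v] <:+: G.seqOrder ∧ ∀ p, ¬ [a, v] <:+: procOrder log p

/-- The number of deviations in the whole execution. -/
noncomputable def deviations (p₀ : Fin P) (σ : Adversary P) (x : ℕ → Fin P) : ℝ≥0∞ :=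
  ⨆ n, (({v | G.IsDeviation (G.run p₀ σ x n).log v}.ncard : ℕ) : ℝ≥0∞)

end Runs

end FutureDag

open scoped Classical in
/-- The number of misses of a fully associative LRU cache with `C` lines on a sequence of accesses to
memory blocks; `cache` lists the blocks present, most recently used first. -/
noncomputable def lruMisses {B : Type*} (C : ℕ) (cache : List B) : List B → ℕ
  | [] => 0
  | m :: ms => (if m ∈ cache then 0 else 1) + lruMisses C ((m :: cache.erase m).take C) ms

namespace FutureDag

variable {V : Type*} [Fintype V] (G : FutureDag V) {P : ℕ} {B : Type*}

/-- The number of cache misses of the sequential execution, where the instructions of the task `v`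
access the memory blocks `acc v` in this order, and the cache is empty at first. -/
noncomputable def seqMisses (C : ℕ) (acc : V → List B) : ℕ :=
  lruMisses C [] (G.seqOrder.flatMap acc)

/-- The total number of cache misses in the whole execution, each processor having its own
initially empty cache with `C` lines. -/
noncomputable def misses (C : ℕ) (acc : V → List B) (p₀ : Fin P) (σ : Adversary P)
    (x : ℕ → Fin P) : ℝ≥0∞ :=
  ⨆ n, ((∑ p, lruMisses C [] ((procOrder (G.run p₀ σ x n).log p).flatMap acc) : ℕ) : ℝ≥0∞)

end FutureDag

/-! Three estimates are combined. If `m` nodes are stolen, then there are at most `4 * G.span * m`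
deviations (`ncard_deviation_le`); each deviation costs at most `C` additional misses (`misses_le`);
and the expected number of steal attempts before the end of the execution is of order `P * G.span`
for fixed `b` (`lintegral_liveAttempt_le`).

Deviations. Continuation and future edges form a tree, and all edges respect its depth-first order
(`Reaches.precedes`). Hence the local parent of a touch other than the final node is a descendant of
the right child of the fork (`right_reaches_local`), and the touch cannot become ready before that
right child has been executed. An unstolen right child `r` thus waits in the deque until its future
thread ends, and is executed immediately after the last node of that thread, unless the thread meets
a late touch, where its local part arrives before the future part (`tracked_run`). So every
deviation is a late touch, a stolen right child, or the right child belonging to a future thread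
with a late touch. A late touch other than the final node belongs to a thread whose right child was
stolen, or which contains an earlier late touch (`exists_source_of_late`). Iterating leads back to a
stolen node `s` in some number `i` of rounds. Since a thread has at most one touch other than the
final node, the pair `(s, i)` determines the late touch (`TouchChain.unique`), and `i` is smaller
than the span. The super final node itself adds at most one deviation, and none without steals.

Misses. While a processor follows the sequential order, its LRU cache and the sequential one agree
on ever more of their most recent blocks, so the discrepancy left by a deviation is paid for at most
`C` times (`LruClose.access`).

Steals. A node at depth `d` of the enabling tree has weight `6 ^ (span - d)`. The potential counts
it four times in a deque, and between once and twice in the hands of a processor, where it decays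
with the steal attempts made since the last step of that processor; the yield rule bounds this
clock. Executing a node never increases the potential, and a steal attempt lowers it on average by
the factor `1 - 1 / (3 * (b + 1) * P)`, because a deque carries most of its weight in its top node.
The logarithm of the potential starts below `1 + 5 * span`, and a drift argument finishes the proof.
-/

namespace FutureDag

variable {V : Type*} (G : FutureDag V)

/-! ### Reachability and threads -/

variable {G}

theorem not_transGen_self (v : V) : ¬ Relation.TransGen G.Edge v v := G.acyclic v

theorem Reaches.not_edge {a b : V} (h : G.Reaches a b) : ¬ G.Edge b a := fun e =>
  not_transGen_self a (Relation.TransGen.tail' h e)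

theorem edge_of_cont {a b : V} (h : G.cont a = some b) : G.Edge a b := Or.inl h

theorem edge_of_spawn {a b : V} (h : G.spawn a = some b) : G.Edge a b := Or.inr (Or.inl h)

theorem edge_of_touch {a b : V} (h : G.touch a b) : G.Edge a b := Or.inr (Or.inr h)

theorem Edge.ne {a b : V} (h : G.Edge a b) : a ≠ b := by
  rintro rfl
  exact not_transGen_self a (Relation.TransGen.single h)

theorem Edge.ne_final {a b : V} (h : G.Edge a b) : a ≠ G.final := by
  rintro rfl
  obtain ⟨h1, h2, h3⟩ := G.final_sink
  rcases h with h | h | h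
  · simp [h1] at h
  · simp [h2] at h
  · exact h3 _ h

theorem InThread.reaches {a b : V} (h : G.InThread a b) : G.Reaches a b :=
  Relation.ReflTransGen.mono (fun _ _ h => edge_of_cont h) _ _ h

theorem InThread.tail {a b c : V} (h : G.InThread a b) (e : G.cont b = some c) : G.InThread a c :=
  Relation.ReflTransGen.tail h e

theorem Reaches.tail {a b c : V} (h : G.Reaches a b) (e : G.Edge b c) : G.Reaches a c :=
  Relation.ReflTransGen.tail h e

theorem Reaches.trans {a b c : V} (h : G.Reaches a b) (e : G.Reaches b c) : G.Reaches a c :=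
  Relation.ReflTransGen.trans h e

theorem wellFounded_transGen [Finite V] : WellFounded (Relation.TransGen G.Edge) :=
  haveI : Std.Irrefl (Relation.TransGen G.Edge) := ⟨not_transGen_self⟩
  Finite.wellFounded_of_trans_of_irrefl _

theorem wellFounded_edge [Finite V] : WellFounded G.Edge :=
  Subrelation.wf (fun h => Relation.TransGen.single h) wellFounded_transGen

theorem wellFounded_edge_swap [Finite V] : WellFounded (fun a b => G.Edge b a) :=
  haveI : Std.Irrefl (fun a b => Relation.TransGen G.Edge b a) := ⟨not_transGen_self⟩
  haveI : IsTrans V (fun a b => Relation.TransGen G.Edge b a) := ⟨fun _ _ _ h h' => h'.trans h⟩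
  Subrelation.wf (fun h => Relation.TransGen.single h)
    (Finite.wellFounded_of_trans_of_irrefl (fun a b => Relation.TransGen G.Edge b a))

/-- Every node lies on a thread with a last node. -/
theorem exists_thread_end [Finite V] (a : V) : ∃ e, G.InThread a e ∧ G.cont e = none := by
  induction a using G.wellFounded_edge_swap.induction with
  | _ a ih =>
    rcases h : G.cont a with _ | b
    · exact ⟨a, Relation.ReflTransGen.refl, h⟩
    · obtain ⟨e, he, he'⟩ := ih b (edge_of_cont h)
      exact ⟨e, Relation.ReflTransGen.head h he, he'⟩

theorem reaches_final [Finite V] (a : V) : G.Reaches a G.final := by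
  induction a using G.wellFounded_edge_swap.induction with
  | _ a ih =>
    by_cases ha : a = G.final
    · subst ha; exact Relation.ReflTransGen.refl
    rcases h : G.cont a with _ | b
    · obtain ⟨x, hx⟩ := G.last_touch a h ha
      exact Relation.ReflTransGen.head (edge_of_touch hx) (ih x (edge_of_touch hx))
    · exact Relation.ReflTransGen.head (edge_of_cont h) (ih b (edge_of_cont h))

theorem root_reaches [Finite V] (a : V) : G.Reaches G.root a := by
  induction a using G.wellFounded_edge.induction with
  | _ a ih =>
    by_cases ha : a = G.root
    · subst ha; exact Relation.ReflTransGen.refl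
    rcases G.has_parent a ha with ⟨b, hb⟩ | ⟨b, hb⟩
    · exact (ih b (edge_of_cont hb)).tail (edge_of_cont hb)
    · exact (ih b (edge_of_spawn hb)).tail (edge_of_spawn hb)

theorem not_edge_root (a : V) : ¬ G.Edge a G.root := by
  obtain ⟨h1, h2, h3⟩ := G.root_source a
  rintro (h | h | h)
  exacts [h1 h, h2 h, h3 h]

/-! ### The tree of continuation and future edges -/

variable (G) in
/-- There is a continuation or future edge from `a` to `b`. -/
def TreeEdge (a b : V) : Prop := G.cont a = some b ∨ G.spawn a = some b

variable (G) in
/-- There is a path of continuation and future edges from `a` to `b`. -/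
def TreeReaches (a b : V) : Prop := Relation.ReflTransGen G.TreeEdge a b

theorem TreeEdge.edge {a b : V} (h : G.TreeEdge a b) : G.Edge a b := by
  rcases h with h | h
  exacts [edge_of_cont h, edge_of_spawn h]

theorem TreeReaches.reaches {a b : V} (h : G.TreeReaches a b) : G.Reaches a b :=
  Relation.ReflTransGen.mono (fun _ _ h => h.edge) _ _ h

theorem TreeReaches.trans {a b c : V} (h : G.TreeReaches a b) (h' : G.TreeReaches b c) :
    G.TreeReaches a c := Relation.ReflTransGen.trans h h'

theorem InThread.treeReaches {a b : V} (h : G.InThread a b) : G.TreeReaches a b :=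
  Relation.ReflTransGen.mono (fun _ _ h => Or.inl h) _ _ h

/-- The target of a future edge has no incoming continuation edge, so continuation and future edges
together give every node at most one parent. -/
theorem TreeEdge.left_unique {a b c : V} (h : G.TreeEdge a c) (h' : G.TreeEdge b c) : a = b := by
  rcases h with h | h <;> rcases h' with h' | h'
  · exact G.cont_inj h h'
  · exact absurd h (G.spawn_first h' a)
  · exact absurd h' (G.spawn_first h b)
  · exact G.spawn_inj h h'

theorem TreeReaches.total {a b c : V} (h : G.TreeReaches a c) (h' : G.TreeReaches b c) :
    G.TreeReaches a b ∨ G.TreeReaches b a := by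
  have h1 : Relation.ReflTransGen (Function.swap G.TreeEdge) c a :=
    Relation.reflTransGen_swap.2 h
  have h2 : Relation.ReflTransGen (Function.swap G.TreeEdge) c b :=
    Relation.reflTransGen_swap.2 h'
  have U : Relator.RightUnique (Function.swap G.TreeEdge) := fun _ _ _ h h' => h.left_unique h'
  rcases Relation.ReflTransGen.total_of_right_unique U h1 h2 with h | h
  · exact Or.inr (Relation.reflTransGen_swap.1 h)
  · exact Or.inl (Relation.reflTransGen_swap.1 h)

theorem TreeReaches.eq_or_parent {a b c : V} (h : G.TreeReaches a c) (e : G.TreeEdge b c) :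
    a = c ∨ G.TreeReaches a b := by
  rcases Relation.ReflTransGen.cases_tail h with h | ⟨d, hd, hdc⟩
  · exact Or.inl h.symm
  · rw [hdc.left_unique e] at hd
    exact Or.inr hd

variable (G) in
/-- `v` is a fork with future thread starting at `f` and right child `r`. -/
def IsFork (v f r : V) : Prop := G.spawn v = some f ∧ G.cont v = some r

namespace IsFork

variable {v f r : V}

theorem ne (h : G.IsFork v f r) : f ≠ r := by
  rintro rfl
  exact G.spawn_first h.1 v h.2

theorem edge_left (h : G.IsFork v f r) : G.Edge v f := edge_of_spawn h.1

theorem edge_right (h : G.IsFork v f r) : G.Edge v r := edge_of_cont h.2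

theorem tree_left (h : G.IsFork v f r) : G.TreeReaches v f :=
  Relation.ReflTransGen.single (Or.inr h.1)

theorem tree_right (h : G.IsFork v f r) : G.TreeReaches v r :=
  Relation.ReflTransGen.single (Or.inl h.2)

theorem not_touch_right (h : G.IsFork v f r) (u : V) : ¬ G.touch u r :=
  (G.fork_children h.1 u).2 r h.2

theorem not_touch_left (h : G.IsFork v f r) (u : V) : ¬ G.touch u f :=
  (G.fork_children h.1 u).1

theorem not_tree_left_right (h : G.IsFork v f r) : ¬ G.TreeReaches f r := fun k => by
  rcases k.eq_or_parent (Or.inl h.2) with k | k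
  · exact h.ne k
  · exact k.reaches.not_edge h.edge_left

theorem not_tree_right_left (h : G.IsFork v f r) : ¬ G.TreeReaches r f := fun k => by
  rcases k.eq_or_parent (Or.inr h.1) with k | k
  · exact h.ne k.symm
  · exact k.reaches.not_edge h.edge_right

theorem edge_left_iff (h : G.IsFork v f r) {d : V} : G.Edge d f ↔ d = v := by
  refine ⟨?_, fun e => e ▸ h.edge_left⟩
  rintro (e | e | e)
  · exact absurd e (G.spawn_first h.1 d)
  · exact G.spawn_inj e h.1
  · exact absurd e (h.not_touch_left d)

theorem edge_right_iff (h : G.IsFork v f r) {d : V} : G.Edge d r ↔ d = v := by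
  refine ⟨?_, fun e => e ▸ h.edge_right⟩
  rintro (e | e | e)
  · exact G.cont_inj e h.2
  · exact absurd h.2 (G.spawn_first e v)
  · exact absurd e (h.not_touch_right d)

end IsFork

theorem exists_isFork {v f : V} (h : G.spawn v = some f) : ∃ r, G.IsFork v f r := by
  obtain ⟨r, hr⟩ := G.fork_cont h
  exact ⟨r, h, hr⟩

variable (G) in
/-- `a` precedes `b` in the depth-first order and is no ancestor of `b` in the tree. -/
def Before (a b : V) : Prop := ∃ v f r, G.IsFork v f r ∧ G.TreeReaches f a ∧ G.TreeReaches r b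

/-- The subtrees of the two children of a fork are disjoint: the ancestors of a common node would be
comparable, so one child would lie above the other, hence above the fork. -/
theorem Before.irrefl (a : V) : ¬ G.Before a a := by
  rintro ⟨v, f, r, h, hf, hr⟩
  rcases hf.total hr with k | k
  exacts [h.not_tree_left_right k, h.not_tree_right_left k]

theorem Before.trans_tree {a b c : V} (h : G.Before a b) (h' : G.TreeReaches b c) :
    G.Before a c := by
  obtain ⟨v, f, r, h, hf, hr⟩ := h
  exact ⟨v, f, r, h, hf, hr.trans h'⟩

/-- The right child of the first fork and the left child of the second are both ancestors of `b`,
hence comparable, and they differ because only one of them starts a thread. The upper of the two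
forks separates `a` from `c`. -/
theorem Before.trans {a b c : V} (h : G.Before a b) (h' : G.Before b c) : G.Before a c := by
  obtain ⟨v, f, r, h, hf, hr⟩ := h
  obtain ⟨v', f', r', h', hf', hr'⟩ := h'
  rcases hr.total hf' with k | k
  · rcases k.eq_or_parent (Or.inr h'.1) with k | k
    · exact absurd h.2 (k ▸ G.spawn_first h'.1 v)
    · exact ⟨v, f, r, h, hf, (k.trans h'.tree_right).trans hr'⟩
  · rcases k.eq_or_parent (Or.inl h.2) with k | k
    · exact absurd h.2 (k ▸ G.spawn_first h'.1 v)
    · exact ⟨v', f', r', h', (k.trans h.tree_left).trans hf, hr'⟩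

variable (G) in
/-- `a` precedes `b` in the depth-first order of the tree, or is equal to it. -/
def Precedes (a b : V) : Prop := G.TreeReaches a b ∨ G.Before a b

theorem Precedes.trans {a b c : V} (h : G.Precedes a b) (h' : G.Precedes b c) :
    G.Precedes a c := by
  rcases h with h | h <;> rcases h' with h' | h'
  · exact Or.inl (h.trans h')
  · obtain ⟨v, f, r, k, hf, hr⟩ := h'
    rcases h.total hf with e | e
    · rcases e.eq_or_parent (Or.inr k.1) with e | e
      · exact Or.inr ⟨v, f, r, k, e ▸ Relation.ReflTransGen.refl, hr⟩
      · exact Or.inl ((e.trans k.tree_right).trans hr)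
    · exact Or.inr ⟨v, f, r, k, e, hr⟩
  · exact Or.inr (h.trans_tree h')
  · exact Or.inr (h.trans h')

theorem IsFork.not_precedes {v f r p : V} (h : G.IsFork v f r) (hf : G.TreeReaches f p) :
    ¬ G.Precedes r p := by
  rintro (k | k)
  · exact Before.irrefl p ⟨v, f, r, h, hf, k⟩
  · exact Before.irrefl r (k.trans ⟨v, f, r, h, hf, Relation.ReflTransGen.refl⟩)

/-- The first node of the thread of a tree ancestor of a node of a thread. -/
theorem InThread.of_treeReaches {f f' c : V} (h : G.InThread f' c) (k : G.TreeReaches f c) :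
    G.TreeReaches f f' ∨ G.InThread f' f := by
  induction h with
  | refl => exact Or.inl k
  | tail hb e ih =>
    rcases k.eq_or_parent (Or.inl e) with k | k
    · subst k; exact Or.inr (InThread.tail hb e)
    · exact ih k

theorem InThread.total {a b c : V} (h : G.InThread a c) (h' : G.InThread b c) :
    G.InThread a b ∨ G.InThread b a := by
  have U : Relator.RightUnique (Function.swap (fun a b => G.cont a = some b)) :=
    fun _ _ _ h h' => G.cont_inj h h'
  rcases Relation.ReflTransGen.total_of_right_unique U (Relation.reflTransGen_swap.2 h)
    (Relation.reflTransGen_swap.2 h') with h | h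
  · exact Or.inr (Relation.reflTransGen_swap.1 h)
  · exact Or.inl (Relation.reflTransGen_swap.1 h)

theorem InThread.eq_of_first {a f : V} (h : G.InThread a f) (hf : ∀ c, G.cont c ≠ some f) :
    a = f := by
  rcases Relation.ReflTransGen.cases_tail h with h | ⟨d, _, hd⟩
  · exact h.symm
  · exact absurd hd (hf d)

/-- A node lies in only one thread. -/
theorem InThread.unique {f f' c : V} (h : G.InThread f c) (h' : G.InThread f' c)
    (hf : ∀ c, G.cont c ≠ some f) (hf' : ∀ c, G.cont c ≠ some f') : f = f' := by
  rcases h.total h' with k | k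
  · exact k.eq_of_first hf'
  · exact (k.eq_of_first hf).symm

theorem cont_rightUnique : Relator.RightUnique (fun a b => G.cont a = some b) :=
  fun _ _ _ h h' => Option.some.inj ((show _ = some _ from h).symm.trans h')

theorem InThread.end_unique {a e e' : V} (h : G.InThread a e) (h' : G.InThread a e')
    (he : G.cont e = none) (he' : G.cont e' = none) : e = e' := by
  have key : ∀ {x y : V}, G.cont x = none → G.InThread x y → x = y := fun hx k => by
    rcases Relation.ReflTransGen.cases_head k with k | ⟨c, hc, _⟩
    · exact k
    · simp [hx] at hc
  rcases Relation.ReflTransGen.total_of_right_unique cont_rightUnique h h' with k | k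
  · exact key he k
  · exact (key he' k).symm

theorem root_first (c : V) : G.cont c ≠ some G.root := (G.root_source c).1

/-- The final node lies in no future thread. -/
theorem ne_final_of_inThread {v f y : V} (h : G.spawn v = some f) (hy : G.InThread f y) :
    y ≠ G.final := by
  rintro rfl
  have := hy.unique G.main_thread (G.spawn_first h) root_first
  exact (G.root_source v).2.1 (this ▸ h)

theorem mem_main_or_future [Finite V] (a : V) : G.InThread G.root a ∨
    ∃ v f, G.spawn v = some f ∧ G.InThread f a := by
  induction a using G.wellFounded_edge.induction with
  | _ a ih =>
    by_cases ha : a = G.root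
    · subst ha; exact Or.inl Relation.ReflTransGen.refl
    rcases G.has_parent a ha with ⟨b, hb⟩ | ⟨b, hb⟩
    · rcases ih b (edge_of_cont hb) with h | ⟨v, f, h, h'⟩
      · exact Or.inl (h.tail hb)
      · exact Or.inr ⟨v, f, h, h'.tail hb⟩
    · exact Or.inr ⟨b, a, hb, Relation.ReflTransGen.refl⟩

theorem mem_main_or_below [Finite V] (a : V) : G.InThread G.root a ∨
    ∃ v f r, G.IsFork v f r ∧ G.InThread G.root v ∧ G.TreeReaches f a := by
  induction a using G.wellFounded_edge.induction with
  | _ a ih =>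
    by_cases ha : a = G.root
    · subst ha; exact Or.inl Relation.ReflTransGen.refl
    rcases G.has_parent a ha with ⟨b, hb⟩ | ⟨b, hb⟩
    · rcases ih b (edge_of_cont hb) with h | ⟨v, f, r, h, hv, h'⟩
      · exact Or.inl (h.tail hb)
      · exact Or.inr ⟨v, f, r, h, hv, Relation.ReflTransGen.tail h' (Or.inl hb)⟩
    · rcases ih b (edge_of_spawn hb) with h | ⟨v, f, r, h, hv, h'⟩
      · obtain ⟨r, hr⟩ := exists_isFork hb
        exact Or.inr ⟨b, a, r, hr, h, Relation.ReflTransGen.refl⟩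
      · exact Or.inr ⟨v, f, r, h, hv, Relation.ReflTransGen.tail h' (Or.inr hb)⟩

theorem inThread_final_of_main {a : V} (h : G.InThread G.root a) : G.InThread a G.final := by
  rcases Relation.ReflTransGen.total_of_right_unique cont_rightUnique h G.main_thread with k | k
  · exact k
  · rcases Relation.ReflTransGen.cases_head k with k | ⟨c, hc, _⟩
    · exact k ▸ Relation.ReflTransGen.refl
    · simp [G.final_sink.1] at hc

theorem precedes_final [Finite V] (a : V) : G.Precedes a G.final := by
  rcases mem_main_or_below (G := G) a with h | ⟨v, f, r, h, hv, ha⟩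
  · exact Or.inl (inThread_final_of_main h).treeReaches
  · exact Or.inr ⟨v, f, r, h, ha, (inThread_final_of_main (hv.tail h.2)).treeReaches⟩

/-- The depth-first order of the tree is compatible with all edges. -/
theorem Reaches.precedes [Finite V] (hG : G.IsSuperFinalSingleTouch) {a b : V}
    (h : G.Reaches a b) : G.Precedes a b := by
  induction b using G.wellFounded_edge.induction generalizing a with
  | _ b ih =>
    rcases Relation.ReflTransGen.cases_tail h with rfl | ⟨u, hu, e⟩
    · exact Or.inl Relation.ReflTransGen.refl
    refine (ih u e hu).trans ?_
    rcases e with e' | e' | e'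
    · exact Or.inl (Relation.ReflTransGen.single (Or.inl e'))
    · exact Or.inl (Relation.ReflTransGen.single (Or.inr e'))
    by_cases hb : b = G.final
    · exact hb ▸ precedes_final u
    obtain ⟨v, f, hv, hfu, -⟩ := G.touch_source e'
    obtain ⟨r, hr⟩ := exists_isFork hv
    obtain ⟨p, hp⟩ := G.touch_local e'
    obtain ⟨hrb, hvp⟩ := (hG v f r hr.1 hr.2).2.2 b ⟨u, hfu, e'⟩ hb
    have hvp := hvp p hp
    have hpb : G.TreeReaches p b := Relation.ReflTransGen.single (Or.inl hp)
    have hfu' : G.TreeReaches f u := InThread.treeReaches hfu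
    rcases ih p (edge_of_cont hp) hvp with k | ⟨v', f', r', k, hv', hp'⟩
    · rcases Relation.ReflTransGen.cases_head k with k | ⟨c, hc, hcp⟩
      · subst k
        rw [hr.2] at hp
        obtain rfl := Option.some.inj hp
        exact absurd e' (hr.not_touch_right u)
      rcases hc with hc | hc
      · rw [hr.2] at hc
        obtain rfl := Option.some.inj hc
        exact Or.inr ⟨v, f, r, hr, hfu', hcp.trans hpb⟩
      · rw [hr.1] at hc
        obtain rfl := Option.some.inj hc
        -- If `p` lay below `f`, then the path from `r` to `b` would enter `b` through `p` or `u`,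
        -- both below `f`. By induction `r` precedes whatever it reaches there, and it precedes
        -- nothing below `f`.
        exfalso
        rcases Relation.ReflTransGen.cases_tail hrb with h1 | ⟨d, hd, hdb⟩
        · exact hr.not_touch_right u (h1 ▸ e')
        · rcases hdb with h2 | h2 | h2
          · rw [G.cont_inj h2 hp] at hd
            exact hr.not_precedes hcp (ih p (edge_of_cont hp) hd)
          · exact G.spawn_first h2 _ hp
          · rw [G.touch_unique h2 e' hb] at hd
            exact hr.not_precedes hfu' (ih u (edge_of_touch e') hd)
    · exact Or.inr ⟨v', f', r', k, (hv'.trans hr.tree_left).trans hfu', hp'.trans hpb⟩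

/-- What is reached from a future thread without lying below it in the tree is reached through the
touch of the thread. -/
theorem exists_touch_of_reaches [Finite V] (hG : G.IsSuperFinalSingleTouch) {v f r : V}
    (hv : G.IsFork v f r) {y : V} (h : G.Reaches f y) (hy : ¬ G.TreeReaches f y)
    (hy' : y ≠ G.final) : ∃ x, G.IsTouchOf f x ∧ x ≠ G.final ∧ G.Reaches x y := by
  induction y using G.wellFounded_edge.induction with
  | _ y ih =>
    rcases Relation.ReflTransGen.cases_tail h with rfl | ⟨c, hc, e⟩
    · exact absurd Relation.ReflTransGen.refl hy
    by_cases hfc : G.TreeReaches f c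
    · rcases id e with e' | e' | e'
      · exact absurd (Relation.ReflTransGen.tail hfc (Or.inl e')) hy
      · exact absurd (Relation.ReflTransGen.tail hfc (Or.inr e')) hy
      obtain ⟨v', f', hv', hfc', -⟩ := G.touch_source e'
      obtain ⟨r', hr'⟩ := exists_isFork hv'
      by_cases hff : f' = f
      · subst hff
        exact ⟨y, ⟨c, hfc', e'⟩, hy', Relation.ReflTransGen.refl⟩
      -- Here `c` leaves a thread nested below `f`, so the fork of that thread also lies below `f`.
      -- The local parent `p` of `y` is a descendant of that fork, hence reached from `f` without
      -- lying below it, and the induction applies to `p`.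
      have hff' : G.TreeReaches f v' := by
        rcases InThread.of_treeReaches hfc' hfc with k | k
        · rcases k.eq_or_parent (Or.inr hv') with k | k
          · exact absurd k.symm hff
          · exact k
        · exact absurd (k.eq_of_first (G.spawn_first hv.1)) hff
      obtain ⟨p, hp⟩ := G.touch_local e'
      have hvp := ((hG v' f' r' hr'.1 hr'.2).2.2 y ⟨c, hfc', e'⟩ hy').2 p hp
      obtain ⟨x, hx, hx', hxp⟩ := ih p (edge_of_cont hp) (hff'.reaches.trans hvp)
        (fun k => hy (Relation.ReflTransGen.tail k (Or.inl hp))) (edge_of_cont hp).ne_final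
      exact ⟨x, hx, hx', hxp.tail (edge_of_cont hp)⟩
    · obtain ⟨x, hx, hx', hxc⟩ := ih c e hc hfc e.ne_final
      exact ⟨x, hx, hx', hxc.tail e⟩

/-- The local parent of a touch other than the final node is a descendant of the right child. -/
theorem right_reaches_local [Finite V] (hG : G.IsSuperFinalSingleTouch) {v f r x p : V}
    (hv : G.IsFork v f r) (hx : G.IsTouchOf f x) (hx' : x ≠ G.final) (hp : G.cont p = some x) :
    G.Reaches r p := by
  obtain ⟨-, huniq, hdesc⟩ := hG v f r hv.1 hv.2
  obtain ⟨hrx, hvp⟩ := hdesc x hx hx'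
  rcases Relation.ReflTransGen.cases_head (hvp p hp) with k | ⟨c, hc, hcp⟩
  · subst k
    obtain ⟨u, -, hu⟩ := hx
    rw [hv.2] at hp
    obtain rfl := Option.some.inj hp
    exact absurd hu (hv.not_touch_right u)
  rcases hc with hc | hc | hc
  · rw [hv.2] at hc
    obtain rfl := Option.some.inj hc
    exact hcp
  · rw [hv.1] at hc
    obtain rfl := Option.some.inj hc
    -- A path from `f` to `p` would leave the subtree of `f` through the touch of the thread, which
    -- is `x` by uniqueness. This gives a cycle, as `p` is a parent of `x`.
    exfalso
    have hfp : ¬ G.TreeReaches f p := fun k =>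
      hv.not_precedes (Relation.ReflTransGen.tail k (Or.inl hp)) (hrx.precedes hG)
    obtain ⟨x', hx1, hx2, hx3⟩ := exists_touch_of_reaches hG hv hcp hfp (edge_of_cont hp).ne_final
    rw [huniq x' x hx1 hx hx2 hx'] at hx3
    exact hx3.not_edge (edge_of_cont hp)
  · exact absurd hc (G.fork_no_touch hv.1 c)

/-! ### The span -/

theorem isChain_nodup {l : List V} (h : l.IsChain G.Edge) : l.Nodup := by
  have h1 : l.IsChain (Relation.TransGen G.Edge) := h.imp (fun _ _ e => Relation.TransGen.single e)
  have h2 := List.isChain_iff_pairwise.1 h1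
  exact h2.imp (fun {a b} e => by rintro rfl; exact not_transGen_self a e)

theorem le_span [Fintype V] {l : List V} {n : ℕ} (h : l.IsChain G.Edge) (hn : l.length = n + 1) :
    n ≤ G.span := by
  classical
  refine le_csSup ⟨Fintype.card V, ?_⟩ ⟨l, h, hn⟩
  rintro m ⟨l', h', hm⟩
  have := (isChain_nodup h').length_le_card
  omega

theorem Edge.one_le_span [Fintype V] {a b : V} (h : G.Edge a b) : 1 ≤ G.span :=
  le_span (l := [a, b]) (by simpa using h) rfl

end FutureDag

/-! ### Executed nodes -/

section Log

variable {V : Type*} {P : ℕ}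

theorem executed_cons {log : List (Fin P × V)} {p : Fin P} {a v : V} :
    Executed ((p, a) :: log) v ↔ v = a ∨ Executed log v := by
  simp [Executed]

theorem Executed.cons {log : List (Fin P × V)} {v : V} (h : Executed log v) (e : Fin P × V) :
    Executed (e :: log) v := executed_cons.2 (Or.inr h)

theorem procOrder_cons_self (log : List (Fin P × V)) (p : Fin P) (a : V) :
    procOrder ((p, a) :: log) p = procOrder log p ++ [a] := by
  simp [procOrder]

theorem procOrder_cons_of_ne (log : List (Fin P × V)) {p q : Fin P} (a : V) (h : p ≠ q) :
    procOrder ((p, a) :: log) q = procOrder log q := by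
  simp [procOrder, h]

theorem mem_procOrder {log : List (Fin P × V)} {p : Fin P} {a : V} :
    a ∈ procOrder log p ↔ (p, a) ∈ log := by
  simp [procOrder]

theorem executed_iff_exists {log : List (Fin P × V)} {a : V} :
    Executed log a ↔ ∃ p, a ∈ procOrder log p := by
  simp [Executed, mem_procOrder]

theorem procOrder_nodup {log : List (Fin P × V)} (h : (log.map Prod.snd).Nodup) (p : Fin P) :
    (procOrder log p).Nodup := by
  unfold procOrder
  rw [List.nodup_reverse]
  exact (List.filter_sublist.map Prod.snd).nodup h

/-- The nodes that a processor is going to execute, or holds in its deque. -/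
def WSState.held (s : WSState V P) (p : Fin P) : List V := (s.cur p).toList ++ s.dq p

end Log

namespace FutureDag

variable {V : Type*} {G : FutureDag V} {P : ℕ}

theorem cont_ne_of_touch {a x : V} (h : G.touch a x) : G.cont a ≠ some x := by
  obtain ⟨v, f, hv, hfa, hfx⟩ := G.touch_source h
  exact fun e => hfx (Relation.ReflTransGen.tail hfa e)

theorem touch_unique_target (hG : G.IsSuperFinalSingleTouch) {a x y : V} (hx : G.touch a x)
    (hy : G.touch a y) (hx' : x ≠ G.final) (hy' : y ≠ G.final) : x = y := by
  obtain ⟨v, f, hv, hfa, -⟩ := G.touch_source hx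
  obtain ⟨r, hr⟩ := exists_isFork hv
  exact (hG v f r hr.1 hr.2).2.1 x y ⟨a, hfa, hx⟩ ⟨a, hfa, hy⟩ hx' hy'

/-! ### Reachable states -/

variable (G) in
/-- What holds in every state of an execution. -/
structure Valid (s : WSState V P) : Prop where
  idle : ∀ p, s.cur p = none → s.dq p = []
  nodup : ∀ p, (s.held p).Nodup
  disjoint : ∀ p q a, a ∈ s.held p → a ∈ s.held q → p = q
  not_executed : ∀ p a, a ∈ s.held p → ¬ Executed s.log a
  parents : ∀ p a, a ∈ s.held p → ∀ d, G.Edge d a → Executed s.log d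
  closed : ∀ a, Executed s.log a → ∀ d, G.Edge d a → Executed s.log d
  log_nodup : (s.log.map Prod.snd).Nodup
  live : ∀ a, ¬ Executed s.log a → (∀ d, G.Edge d a → Executed s.log d) → ∃ p, a ∈ s.held p

theorem mem_held_of_cur {s : WSState V P} {p : Fin P} {a : V} (h : s.cur p = some a) :
    a ∈ s.held p := by
  simp [WSState.held, h]

theorem mem_held_of_dq {s : WSState V P} {p : Fin P} {a : V} (h : a ∈ s.dq p) :
    a ∈ s.held p := by
  simp [WSState.held, h]

theorem Valid.reaches {s : WSState V P} (h : G.Valid s) {a b : V} (hab : G.Reaches a b)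
    (hb : Executed s.log b) : Executed s.log a := by
  induction hab with
  | refl => exact hb
  | tail _ e ih => exact ih (h.closed _ hb _ e)

/-- The effect of a successful steal. -/
theorem steal_eq {s : WSState V P} {p q : Fin P} {l : List V} {c : V}
    (hq : s.dq q = l ++ [c]) : s.steal p q =
      { cur := Function.update s.cur p (some c)
        dq := Function.update s.dq q l
        log := s.log } := by
  simp [WSState.steal, hq]

theorem steal_eq_self {s : WSState V P} {p q : Fin P} (hq : s.dq q = []) : s.steal p q = s := by
  simp [WSState.steal, hq]

theorem steal_log (s : WSState V P) (p q : Fin P) : (s.steal p q).log = s.log := by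
  unfold WSState.steal; split <;> rfl

theorem Valid.init (p₀ : Fin P) : G.Valid (G.init p₀) := by
  have key : ∀ p a, a ∈ (G.init p₀).held p ↔ p = p₀ ∧ a = G.root := by
    intro p a
    by_cases hp : p = p₀ <;> simp [WSState.held, FutureDag.init, hp, eq_comm (a := a)]
  refine ⟨fun _ _ => rfl, fun p => ?_, fun p q a hp hq => ?_, fun p a _ => ?_, fun p a h d e => ?_,
    fun a h => ?_, ?_, fun a _ h => ⟨p₀, (key _ _).2 ⟨rfl, ?_⟩⟩⟩
  · by_cases hp : p = p₀ <;> simp [WSState.held, FutureDag.init, hp]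
  · rw [((key _ _).1 hp).1, ((key _ _).1 hq).1]
  · simp [Executed, FutureDag.init]
  · exact absurd (((key _ _).1 h).2 ▸ e) (not_edge_root d)
  · simp [Executed, FutureDag.init] at h
  · simp [FutureDag.init]
  · by_contra ha
    rcases G.has_parent a ha with ⟨d, hd⟩ | ⟨d, hd⟩
    · have := h d (edge_of_cont hd)
      simp [Executed, FutureDag.init] at this
    · have := h d (edge_of_spawn hd)
      simp [Executed, FutureDag.init] at this

/-- A steal only moves one node `c` from the deque of `q` to `p`, who held nothing. All conditions
about individual nodes carry over; only the location of `c` changes. -/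
theorem Valid.steal {s : WSState V P} (h : G.Valid s) {p : Fin P} (hp : s.cur p = none)
    (q : Fin P) : G.Valid (s.steal p q) := by
  rcases List.eq_nil_or_concat' (s.dq q) with hq | ⟨l, c, hq⟩
  · rwa [steal_eq_self hq]
  have hqp : p ≠ q := by
    rintro rfl
    simp [h.idle p hp] at hq
  have hdp := h.idle p hp
  set s' := s.steal p q with hs'
  have e := steal_eq (p := p) hq
  have hlog : s'.log = s.log := by rw [hs', e]
  have hp' : s'.held p = [c] := by
    simp [hs', e, WSState.held, hqp, hdp]
  have hq' : s.held q = s'.held q ++ [c] := by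
    simp [hs', e, WSState.held, hqp.symm, hq]
  have ho : ∀ o, o ≠ p → o ≠ q → s'.held o = s.held o := by
    intro o h1 h2
    simp [hs', e, WSState.held, h1, h2]
  have hp0 : s.held p = [] := by simp [WSState.held, hp, hdp]
  have hcq : c ∉ s'.held q := by
    have := h.nodup q
    rw [hq', List.nodup_append] at this
    intro k
    exact this.2.2 c k c (by simp) rfl
  have hmem : ∀ o a, a ∈ s'.held o → (a = c ∧ o = p) ∨ (a ≠ c ∧ a ∈ s.held o) := by
    intro o a ha
    by_cases h1 : o = p
    · subst h1
      rw [hp'] at ha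
      exact Or.inl ⟨by simpa using ha, rfl⟩
    by_cases h2 : o = q
    · subst h2
      exact Or.inr ⟨fun k => hcq (k ▸ ha), by rw [hq']; simp [ha]⟩
    · rw [ho o h1 h2] at ha
      refine Or.inr ⟨fun k => h2 (h.disjoint o q c (k ▸ ha) (by rw [hq']; simp)), ha⟩
  have hsub : ∀ o a, a ∈ s'.held o → ∃ o', a ∈ s.held o' := by
    intro o a ha
    rcases hmem o a ha with ⟨k, -⟩ | ⟨-, k⟩
    · exact ⟨q, by rw [hq', k]; simp⟩
    · exact ⟨o, k⟩
  refine ⟨fun o k => ?_, fun o => ?_, fun o o' a ha ha' => ?_, fun o a ha => ?_, fun o a ha => ?_,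
    by rw [hlog]; exact h.closed, by rw [hlog]; exact h.log_nodup, ?_⟩
  · by_cases h1 : o = p
    · subst h1; simp [hs', e] at k
    have h2 : o ≠ q := by
      rintro rfl
      simp only [hs', e, Function.update_of_ne h1] at k
      simp [h.idle o k] at hq
    simp only [hs', e, Function.update_of_ne h1, Function.update_of_ne h2] at k ⊢
    exact h.idle o k
  · by_cases h1 : o = p
    · subst h1; simp [hp']
    by_cases h2 : o = q
    · subst h2
      have := h.nodup o
      rw [hq', List.nodup_append] at this
      exact this.1
    · rw [ho o h1 h2]; exact h.nodup o
  · rcases hmem o a ha with ⟨k, k1⟩ | ⟨k, k1⟩ <;> rcases hmem o' a ha' with ⟨k', k1'⟩ | ⟨k', k1'⟩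
    · rw [k1, k1']
    · exact absurd k k'
    · exact absurd k' k
    · exact h.disjoint _ _ _ k1 k1'
  · obtain ⟨o', k⟩ := hsub o a ha
    rw [hlog]; exact h.not_executed o' a k
  · obtain ⟨o', k⟩ := hsub o a ha
    rw [hlog]; exact h.parents o' a k
  · rw [hlog]
    intro a ha ha'
    obtain ⟨o, k⟩ := h.live a ha ha'
    by_cases h1 : o = p
    · subst h1; simp [hp0] at k
    by_cases h2 : o = q
    · subst h2
      rw [hq', List.mem_append] at k
      rcases k with k | k
      · exact ⟨o, k⟩
      · exact ⟨p, by rwa [hp']⟩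
    · exact ⟨o, by rwa [ho o h1 h2]⟩

variable [Fintype V]

/-! ### Enabled children -/

theorem mem_enabled {log : List (Fin P × V)} {a c : V} :
    c ∈ G.enabled log a ↔ G.Edge a c ∧ ∀ d, G.Edge d c → Executed log d := by
  classical
  rw [enabled, List.mem_filter, decide_eq_true_iff]
  refine and_congr ?_ Iff.rfl
  simp [Edge]
  tauto

theorem enabled_nodup (log : List (Fin P × V)) (a : V) : (G.enabled log a).Nodup := by
  classical
  refine List.Nodup.filter _ ?_
  rw [List.nodup_append, List.nodup_append]
  refine ⟨⟨?_, ?_, ?_⟩, Finset.nodup_toList _, ?_⟩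
  · cases G.spawn a <;> simp
  · cases G.cont a <;> simp
  · rintro c hc d hd rfl
    simp only [Option.mem_toList] at hc hd
    exact G.spawn_first hc a hd
  · rintro c hc d hd rfl
    simp only [List.mem_append, Option.mem_toList, Finset.mem_toList,
      Finset.mem_filter, Finset.mem_univ, true_and] at hc hd
    rcases hc with hc | hc
    · exact G.fork_no_touch hc _ hd
    · exact cont_ne_of_touch hd hc

theorem enabled_fork {v f r : V} (h : G.IsFork v f r) {log : List (Fin P × V)}
    (hv : Executed log v) : G.enabled log v = [f, r] := by
  classical
  have h0 : Finset.univ.filter (G.touch v) = ∅ :=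
    Finset.filter_eq_empty_iff.2 fun x _ => G.fork_no_touch h.1 x
  have hf : ∀ d, G.Edge d f → Executed log d := fun d hd => by rwa [h.edge_left_iff.1 hd]
  have hr : ∀ d, G.Edge d r → Executed log d := fun d hd => by rwa [h.edge_right_iff.1 hd]
  simp only [enabled, h.1, h.2]
  rw [h0]
  simpa using ⟨hf, hr⟩

theorem enabled_cont {a c : V} (hs : G.spawn a = none) (hc : G.cont a = some c)
    {log : List (Fin P × V)} (h : ∀ d, G.Edge d c → Executed log d) :
    ∃ l, G.enabled log a = c :: l ∧ ∀ x ∈ l, G.touch a x := by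
  classical
  refine ⟨(Finset.univ.filter (G.touch a)).toList.filter
    (fun c => ∀ d, G.Edge d c → Executed log d), ?_, ?_⟩
  · simp only [enabled, hs, hc, Option.toList_none, Option.toList_some, List.nil_append,
      List.cons_append]
    exact List.filter_cons_of_pos (by simpa using h)
  · intro x hx
    have := (List.mem_filter.1 hx).1
    simpa using this

theorem held_execute_self (s : WSState V P) (p : Fin P) (a : V) :
    (G.execute s p a).held p = G.enabled ((p, a) :: s.log) a ++ s.dq p := by
  simp only [WSState.held, execute, Function.update_self]
  cases G.enabled ((p, a) :: s.log) a ++ s.dq p <;> rfl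

theorem held_execute_of_ne (s : WSState V P) {p q : Fin P} (a : V) (h : q ≠ p) :
    (G.execute s p a).held q = s.held q := by
  simp [WSState.held, execute, h]

/-- An enabled child has not been executed, and is held by no processor. -/
theorem Valid.of_mem_enabled {s : WSState V P} (h : G.Valid s) {p : Fin P} {a c : V}
    (ha : s.cur p = some a) (hc : c ∈ G.enabled ((p, a) :: s.log) a) :
    ¬ Executed ((p, a) :: s.log) c ∧ ∀ q, c ∉ s.held q := by
  have e := (mem_enabled.1 hc).1
  have hne := h.not_executed p a (mem_held_of_cur ha)
  refine ⟨fun k => ?_, fun q k => hne (h.parents q c k a e)⟩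
  rcases executed_cons.1 k with k | k
  · exact e.ne k.symm
  · exact hne (h.closed c k a e)

theorem Valid.execute {s : WSState V P} (h : G.Valid s) {p : Fin P} {a : V}
    (ha : s.cur p = some a) : G.Valid (G.execute s p a) := by
  have hlog : (G.execute s p a).log = (p, a) :: s.log := rfl
  have hne := h.not_executed p a (mem_held_of_cur ha)
  have hheld : s.held p = a :: s.dq p := by simp [WSState.held, ha]
  have hnd : a ∉ s.dq p ∧ (s.dq p).Nodup := by
    have := h.nodup p
    rw [hheld] at this
    exact List.nodup_cons.1 this
  -- The held nodes change by the removal of `a` and the addition of its enabled children to `p`;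
  -- every field below follows from this description.
  have hmem : ∀ q c, c ∈ (G.execute s p a).held q ↔
      (q = p ∧ c ∈ G.enabled ((p, a) :: s.log) a) ∨ (c ∈ s.held q ∧ c ≠ a) := by
    intro q c
    by_cases hq : q = p
    · subst hq
      rw [held_execute_self, hheld]
      simp only [List.mem_append, true_and, List.mem_cons]
      constructor
      · rintro (k | k)
        · exact Or.inl k
        · exact Or.inr ⟨Or.inr k, fun e => hnd.1 (e ▸ k)⟩
      · rintro (k | ⟨k | k, k'⟩)
        · exact Or.inl k
        · exact absurd k k'
        · exact Or.inr k
    · rw [held_execute_of_ne s a hq]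
      simp only [hq, false_and, false_or]
      exact ⟨fun k => ⟨k, fun e => hq (h.disjoint q p a (e ▸ k) (mem_held_of_cur ha))⟩,
        fun k => k.1⟩
  refine ⟨fun q hq => ?_, fun q => ?_, fun q q' c hc hc' => ?_, fun q c hc => ?_,
    fun q c hc d e => ?_, fun c hc d e => ?_, ?_, fun c hc hd => ?_⟩
  · by_cases hqp : q = p
    · subst hqp
      simp only [FutureDag.execute, Function.update_self, List.head?_eq_none_iff] at hq ⊢
      rw [hq]; rfl
    · simp only [FutureDag.execute, Function.update_of_ne hqp] at hq ⊢
      exact h.idle q hq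
  · by_cases hqp : q = p
    · subst hqp
      rw [held_execute_self, List.nodup_append]
      refine ⟨enabled_nodup _ _, hnd.2, ?_⟩
      rintro c hc d hd rfl
      exact (h.of_mem_enabled ha hc).2 q (mem_held_of_dq hd)
    · rw [held_execute_of_ne s a hqp]
      exact h.nodup q
  · rcases (hmem _ _).1 hc with ⟨rfl, k⟩ | ⟨k, -⟩ <;> rcases (hmem _ _).1 hc' with ⟨e, k'⟩ | ⟨k', -⟩
    · exact e.symm
    · exact absurd k' ((h.of_mem_enabled ha k).2 _)
    · exact absurd k ((h.of_mem_enabled ha k').2 _)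
    · exact h.disjoint _ _ _ k k'
  · rw [hlog]
    rcases (hmem _ _).1 hc with ⟨rfl, k⟩ | ⟨k, k'⟩
    · exact (h.of_mem_enabled ha k).1
    · rw [executed_cons, not_or]
      exact ⟨k', h.not_executed q c k⟩
  · rw [hlog]
    rcases (hmem _ _).1 hc with ⟨rfl, k⟩ | ⟨k, -⟩
    · exact (mem_enabled.1 k).2 d e
    · exact (h.parents q c k d e).cons _
  · rw [hlog] at hc ⊢
    rcases executed_cons.1 hc with rfl | k
    · exact (h.parents p c (mem_held_of_cur ha) d e).cons _
    · exact (h.closed c k d e).cons _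
  · rw [hlog, List.map_cons, List.nodup_cons]
    exact ⟨hne, h.log_nodup⟩
  · rw [hlog] at hc hd
    rw [executed_cons, not_or] at hc
    by_cases hda : G.Edge a c
    · exact ⟨p, (hmem _ _).2 (Or.inl ⟨rfl, mem_enabled.2 ⟨hda, hd⟩⟩)⟩
    · obtain ⟨q, hq⟩ := h.live c hc.2 fun d hdc => by
        rcases executed_cons.1 (hd d hdc) with rfl | k
        exacts [absurd hdc hda, k]
      exact ⟨q, (hmem _ _).2 (Or.inr ⟨hq, hc.1⟩)⟩

section Run

variable {p₀ : Fin P} {σ : Adversary P} {x : ℕ → Fin P}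

theorem run_succ_of_none {n : ℕ} (h : (G.run p₀ σ x n).cur (σ.sched x n) = none) :
    G.run p₀ σ x (n + 1) = (G.run p₀ σ x n).steal (σ.sched x n) (x n) := by
  simp [run, step, h]

theorem run_succ_of_some {n : ℕ} {a : V} (h : (G.run p₀ σ x n).cur (σ.sched x n) = some a) :
    G.run p₀ σ x (n + 1) = G.execute (G.run p₀ σ x n) (σ.sched x n) a := by
  simp [run, step, h]

theorem valid_run (p₀ : Fin P) (σ : Adversary P) (x : ℕ → Fin P) (n : ℕ) :
    G.Valid (G.run p₀ σ x n) := by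
  induction n with
  | zero => exact Valid.init p₀
  | succ n ih =>
    rcases h : (G.run p₀ σ x n).cur (σ.sched x n) with _ | a
    · rw [run_succ_of_none h]; exact ih.steal h _
    · rw [run_succ_of_some h]; exact ih.execute h

/-- Every final segment of the log is the log at an earlier time. -/
theorem exists_run_log_eq {n : ℕ} {l₁ l₂ : List (Fin P × V)}
    (h : (G.run p₀ σ x n).log = l₁ ++ l₂) : ∃ k ≤ n, (G.run p₀ σ x k).log = l₂ := by
  induction n generalizing l₁ with
  | zero =>
    have : l₁ ++ l₂ = [] := h.symm
    rw [List.append_eq_nil_iff] at this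
    exact ⟨0, le_rfl, by rw [this.2]; rfl⟩
  | succ n ih =>
    have lift : ∀ {l}, (G.run p₀ σ x n).log = l ++ l₂ →
        ∃ k ≤ n + 1, (G.run p₀ σ x k).log = l₂ := fun h => by
      obtain ⟨k, hk, hk'⟩ := ih h
      exact ⟨k, by omega, hk'⟩
    rcases hc : (G.run p₀ σ x n).cur (σ.sched x n) with _ | a
    · rw [run_succ_of_none hc, steal_log] at h
      exact lift h
    · rcases l₁ with _ | ⟨e, l₁⟩
      · exact ⟨n + 1, le_rfl, h⟩
      · have h' := h
        rw [run_succ_of_some hc] at h'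
        exact lift (List.cons.inj h').2

end Run

/-! ### At most two children become ready at once -/

/-- Every node reaches the final node, so the latter becomes ready only when all other nodes have
been executed. -/
theorem Valid.eq_final_of_mem_enabled {s : WSState V P} (h : G.Valid s) {p : Fin P} {a c : V}
    (ha : s.cur p = some a) (hf : G.final ∈ G.enabled ((p, a) :: s.log) a)
    (hc : ¬ Executed ((p, a) :: s.log) c) : c = G.final := by
  rcases Relation.ReflTransGen.cases_tail (reaches_final (G := G) c) with k | ⟨d, hcd, hd⟩
  · exact k.symm
  · exact absurd ((h.execute ha).reaches hcd ((mem_enabled.1 hf).2 d hd)) hc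

/-- Besides its continuation, a node that is no fork could enable a touch and the final node. But if
the final node becomes ready, nothing else does, and two other touches of one thread coincide. The
bound matters for `depth_sorted` and for the base 6 of the weights. -/
theorem Valid.length_enabled_le {s : WSState V P} (hG : G.IsSuperFinalSingleTouch) (h : G.Valid s)
    {p : Fin P} {a : V} (ha : s.cur p = some a) :
    (G.enabled ((p, a) :: s.log) a).length ≤ 2 := by
  rcases hs : G.spawn a with _ | f
  · by_contra! hl
    have hnd := enabled_nodup (G := G) ((p, a) :: s.log) a
    have hall : ∀ c ∈ G.enabled ((p, a) :: s.log) a, G.cont a = some c ∨ G.touch a c := by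
      intro c hc
      rcases (mem_enabled.1 hc).1 with e | e | e
      · exact Or.inl e
      · simp [hs] at e
      · exact Or.inr e
    have hnx : ∀ c ∈ G.enabled ((p, a) :: s.log) a, ¬ Executed ((p, a) :: s.log) c :=
      fun c hc => (h.of_mem_enabled ha hc).1
    have hfin : ∀ c, G.final ∈ G.enabled ((p, a) :: s.log) a →
      c ∈ G.enabled ((p, a) :: s.log) a → c = G.final := fun c hf hc =>
        h.eq_final_of_mem_enabled ha hf (hnx c hc)
    have htt : ∀ c d, c ∈ G.enabled ((p, a) :: s.log) a → d ∈ G.enabled ((p, a) :: s.log) a →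
        G.touch a c → G.touch a d → c = d := by
      intro c d hc hd tc td
      by_cases hc' : c = G.final
      · rw [hfin d (hc' ▸ hc) hd, hc']
      by_cases hd' : d = G.final
      · rw [hfin c (hd' ▸ hd) hc, hd']
      exact touch_unique_target hG tc td hc' hd'
    generalize G.enabled ((p, a) :: s.log) a = l at *
    match l, hl with
    | c :: d :: e :: l, _ =>
      have h1 := hall c (by simp)
      have h2 := hall d (by simp)
      have h3 := hall e (by simp)
      have h12 := htt c d (by simp) (by simp)
      have h13 := htt c e (by simp) (by simp)
      have h23 := htt d e (by simp) (by simp)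
      simp only [List.nodup_cons, List.mem_cons, not_or] at hnd
      grind
  · obtain ⟨r, hr⟩ := exists_isFork hs
    rw [enabled_fork hr (executed_cons.2 (Or.inl rfl))]
    rfl

end FutureDag

/-! ### Right children and the ends of their future threads. -/

section Follows

variable {V : Type*} {P : ℕ}

/-- Some processor has executed `c` immediately after `a`, or is going to do so. -/
def WSState.Follows (s : WSState V P) (a c : V) : Prop :=
  (∃ p, s.cur p = some c ∧ (procOrder s.log p).getLast? = some a) ∨
    ∃ p, [a, c] <:+: procOrder s.log p

theorem procOrder_infix_cons {log : List (Fin P × V)} {p : Fin P} {l : List V}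
    (h : l <:+: procOrder log p) (q : Fin P) (a : V) : l <:+: procOrder ((q, a) :: log) p := by
  by_cases hq : q = p
  · subst hq
    rw [procOrder_cons_self]
    exact h.trans (List.prefix_append _ _).isInfix
  · rwa [procOrder_cons_of_ne _ _ hq]

theorem WSState.Follows.executed {s : WSState V P} {a c : V} (h : s.Follows a c) :
    Executed s.log a := by
  rw [executed_iff_exists]
  rcases h with ⟨p, -, h⟩ | ⟨p, h⟩
  · exact ⟨p, List.mem_of_getLast? h⟩
  · exact ⟨p, h.subset (by simp)⟩

theorem WSState.Follows.steal {s : WSState V P} {a c : V} (h : s.Follows a c) {p : Fin P}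
    (hp : s.cur p = none) (q : Fin P) : (s.steal p q).Follows a c := by
  rcases List.eq_nil_or_concat' (s.dq q) with hq | ⟨l, d, hq⟩
  · rwa [FutureDag.steal_eq_self hq]
  rw [FutureDag.steal_eq hq]
  rcases h with ⟨o, ho, h⟩ | h
  · refine Or.inl ⟨o, ?_, h⟩
    have : o ≠ p := by rintro rfl; simp [hp] at ho
    simpa [this] using ho
  · exact Or.inr h

end Follows

namespace FutureDag

variable {V : Type*} {G : FutureDag V} {P : ℕ}

variable (G) in
/-- The local parent of the touch `y` has been executed before the future parent. -/
def Late (log : List (Fin P × V)) (y : V) : Prop :=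
  ∃ p c w l₁ l₂, G.cont c = some y ∧ G.touch w y ∧ log = l₁ ++ (p, c) :: l₂ ∧ ¬ Executed l₂ w

theorem Late.append {log : List (Fin P × V)} {y : V} (h : G.Late log y)
    (l : List (Fin P × V)) : G.Late (l ++ log) y := by
  obtain ⟨p, c, w, l₁, l₂, hc, hw, e, h⟩ := h
  exact ⟨p, c, w, l ++ l₁, l₂, hc, hw, by rw [e, List.append_assoc], h⟩

theorem Late.cons {log : List (Fin P × V)} {y : V} (h : G.Late log y)
    (e : Fin P × V) : G.Late (e :: log) y := h.append [e]

/-- A next node of a thread that is not ready is a late touch. -/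
theorem late_of_not_ready {log : List (Fin P × V)} {p : Fin P} {a c : V} (hc : G.cont a = some c)
    (h : ¬ ∀ d, G.Edge d c → Executed ((p, a) :: log) d) : G.Late ((p, a) :: log) c := by
  push Not at h
  obtain ⟨d, hd, hx⟩ := h
  rw [executed_cons, not_or] at hx
  rcases hd with e | e | e
  · exact absurd (G.cont_inj e hc) hx.1
  · exact absurd hc (G.spawn_first e a)
  · exact ⟨p, a, d, [], log, hc, e, rfl, hx.2⟩

variable (G) in
/-- The situation of the right child `r` of an executed fork `v` with future thread `f`, as long as
`r` has not been stolen: a touch in the thread of `f` is late, or the thread is under way above `r`,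
or `r` follows the last node of the thread. -/
def Tracked (s : WSState V P) (f r : V) : Prop :=
  (∃ y, G.InThread f y ∧ G.Late s.log y) ∨
  (∃ p a l, G.InThread f a ∧ s.cur p = some a ∧ s.dq p = r :: l) ∨
  (∃ p a l₁ l₂, G.InThread f a ∧ s.dq p = l₁ ++ a :: r :: l₂) ∨
  (∃ e, G.InThread f e ∧ G.cont e = none ∧ s.Follows e r)

/-- Steals remove only the top of a deque, the last entry of the list. If this is not `r`, then `r`
and everything nearer to the bottom stay in place. -/
theorem Tracked.steal {s : WSState V P} {f r : V} (h : G.Tracked s f r) {p : Fin P}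
    (hp : s.cur p = none) {q : Fin P} (hr : (s.dq q).getLast? ≠ some r) :
    G.Tracked (s.steal p q) f r := by
  rcases List.eq_nil_or_concat' (s.dq q) with hq | ⟨l, d, hq⟩
  · rwa [steal_eq_self hq]
  have hdr : d ≠ r := by
    rintro rfl
    simp [hq] at hr
  have key : ∀ {o l₁ l₂}, s.dq o = l₁ ++ r :: l₂ →
      ∃ l₂', (s.steal p q).dq o = l₁ ++ r :: l₂' := by
    intro o l₁ l₂ ho
    rw [steal_eq hq]
    by_cases hoq : o = q
    · subst hoq
      simp only [Function.update_self]
      rcases List.eq_nil_or_concat' l₂ with rfl | ⟨l', c, rfl⟩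
      · rw [hq] at ho
        exact absurd (List.append_inj' ho rfl).2 (by simpa using hdr)
      · rw [hq, ← List.cons_append, ← List.append_assoc] at ho
        exact ⟨l', (List.append_inj' ho rfl).1⟩
    · exact ⟨l₂, by simpa [hoq] using ho⟩
  rcases h with ⟨y, hy, h⟩ | ⟨o, a, l', ha, ho, h⟩ | ⟨o, a, l₁, l₂, ha, h⟩ | ⟨e, he, he', h⟩
  · exact Or.inl ⟨y, hy, by rwa [steal_log]⟩
  · obtain ⟨l₂', h'⟩ := key (l₁ := []) h
    refine Or.inr (Or.inl ⟨o, a, l₂', ha, ?_, h'⟩)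
    have : o ≠ p := by rintro rfl; simp [hp] at ho
    rw [steal_eq hq]
    simpa [this] using ho
  · obtain ⟨l₂', h'⟩ := key (l₁ := l₁ ++ [a]) (o := o) (l₂ := l₂) (by simpa using h)
    exact Or.inr (Or.inr (Or.inl ⟨o, a, l₁, l₂', ha, by simpa using h'⟩))
  · exact Or.inr (Or.inr (Or.inr ⟨e, he, he', h.steal hp q⟩))

theorem Valid.infix_of_follows {s : WSState V P} (hs : G.Valid s) {a c : V} (h : s.Follows a c)
    (hc : Executed s.log c) : ∃ p, [a, c] <:+: procOrder s.log p := by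
  rcases h with ⟨p, hp, -⟩ | h
  · exact absurd hc (hs.not_executed p c (mem_held_of_cur hp))
  · exact h

/-- If the right child of a fork has been executed and not been stolen, it follows the last node of
the future thread, unless a touch in that thread is late. -/
theorem Valid.follows_of_tracked {s : WSState V P} (hs : G.Valid s) {f r : V}
    (h : G.Tracked s f r) (hr : Executed s.log r) : (∃ y, G.InThread f y ∧ G.Late s.log y) ∨
      ∃ e, G.InThread f e ∧ G.cont e = none ∧ s.Follows e r := by
  rcases h with h | ⟨o, a, l, -, -, h⟩ | ⟨o, a, l₁, l₂, -, h⟩ | h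
  · exact Or.inl h
  · exact absurd hr (hs.not_executed o r (mem_held_of_dq (by simp [h])))
  · exact absurd hr (hs.not_executed o r (mem_held_of_dq (by simp [h])))
  · exact Or.inr h

variable [Fintype V]

theorem execute_cur_self (s : WSState V P) (p : Fin P) (a : V) :
    (G.execute s p a).cur p = (G.enabled ((p, a) :: s.log) a ++ s.dq p).head? := by
  simp [execute]

theorem execute_dq_self (s : WSState V P) (p : Fin P) (a : V) :
    (G.execute s p a).dq p = (G.enabled ((p, a) :: s.log) a ++ s.dq p).tail := by
  simp [execute]

theorem execute_cur_of_ne (s : WSState V P) {p q : Fin P} (a : V) (h : q ≠ p) :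
    (G.execute s p a).cur q = s.cur q := by
  simp [execute, h]

theorem execute_dq_of_ne (s : WSState V P) {p q : Fin P} (a : V) (h : q ≠ p) :
    (G.execute s p a).dq q = s.dq q := by
  simp [execute, h]

theorem execute_log (s : WSState V P) (p : Fin P) (a : V) :
    (G.execute s p a).log = (p, a) :: s.log := rfl

theorem follows_execute {s : WSState V P} {a c : V} (h : s.Follows a c) {p : Fin P}
    {b : V} (hp : s.cur p = some b) : (G.execute s p b).Follows a c := by
  rcases h with ⟨o, ho, h⟩ | ⟨o, h⟩
  · by_cases hop : o = p
    · subst hop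
      rw [ho] at hp
      obtain rfl := Option.some.inj hp
      obtain ⟨l, hl⟩ := List.getLast?_eq_some_iff.1 h
      refine Or.inr ⟨o, ?_⟩
      rw [execute_log, procOrder_cons_self, hl, List.append_assoc]
      exact List.infix_append' l [a, c] []  |>.trans (by simp)
    · refine Or.inl ⟨o, by rwa [execute_cur_of_ne _ _ hop], ?_⟩
      rwa [execute_log, procOrder_cons_of_ne _ _ (Ne.symm hop)]
  · exact Or.inr ⟨o, procOrder_infix_cons h p b⟩

/-- The node with which a processor continues follows the node just executed. -/
theorem follows_of_head {s : WSState V P} {p : Fin P} {a c : V}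
    (h : (G.enabled ((p, a) :: s.log) a ++ s.dq p).head? = some c) :
    (G.execute s p a).Follows a c := by
  refine Or.inl ⟨p, by rw [execute_cur_self, h], ?_⟩
  rw [execute_log, procOrder_cons_self]
  simp

/-- The future thread runs with `r` waiting at the bottom of the deque. A nested fork puts its own
right child, the next node of the thread, in front of `r`; popping restores the former situation.
The thread can get stuck only at a late touch, and when it ends, `r` is popped. -/
theorem Tracked.execute {s : WSState V P} (hG : G.IsSuperFinalSingleTouch) (hs : G.Valid s)
    {v f r : V} (hv : G.IsFork v f r) (h : G.Tracked s f r) {p : Fin P} {a : V}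
    (hp : s.cur p = some a) : G.Tracked (G.execute s p a) f r := by
  rcases h with ⟨y, hy, h⟩ | ⟨o, b, l, hb, ho, h⟩ | ⟨o, b, l₁, l₂, hb, h⟩ | ⟨e, he, he', h⟩
  · exact Or.inl ⟨y, hy, h.cons _⟩
  · by_cases hop : o = p
    swap
    · exact Or.inr (Or.inl ⟨o, b, l, hb, by rwa [execute_cur_of_ne _ _ hop],
        by rwa [execute_dq_of_ne _ _ hop]⟩)
    subst hop
    rw [ho] at hp
    obtain rfl := Option.some.inj hp
    have hs' := hs.execute ho
    have hr : ¬ Executed ((o, b) :: s.log) r := by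
      have h1 := hs.not_executed o r (mem_held_of_dq (by simp [h]))
      have h2 := hs.nodup o
      rw [WSState.held, ho, h] at h2
      rw [executed_cons, not_or]
      exact ⟨fun k => by simp [k] at h2, h1⟩
    -- As long as `r` has not been executed, no touch of this thread is ready: its local parent is a
    -- descendant of `r`, or it is the final node, which waits for everything else. So nothing is
    -- pushed between the thread and `r`.
    have htouch : ∀ c ∈ G.enabled ((o, b) :: s.log) b, ¬ G.touch b c := by
      intro c hc ht
      have hpar := (mem_enabled.1 hc).2
      by_cases hcf : c = G.final
      · subst hcf
        have hrf : r ≠ G.final := fun k => hv.not_touch_right b (k ▸ ht)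
        exact hrf (hs.eq_final_of_mem_enabled ho hc hr)
      · obtain ⟨q, hq⟩ := G.touch_local ht
        exact hr (hs'.reaches (right_reaches_local hG hv ⟨b, hb, ht⟩ hcf hq)
          (hpar q (edge_of_cont hq)))
    rcases hsp : G.spawn b with _ | f'
    · rcases hc : G.cont b with _ | c
      · have hen : G.enabled ((o, b) :: s.log) b = [] := by
          rw [List.eq_nil_iff_forall_not_mem]
          intro c hc'
          rcases (mem_enabled.1 hc').1 with k | k | k
          · simp [hc] at k
          · simp [hsp] at k
          · exact htouch c hc' k
        refine Or.inr (Or.inr (Or.inr ⟨b, hb, hc, follows_of_head ?_⟩))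
        rw [hen, h]; rfl
      · by_cases hready : ∀ d, G.Edge d c → Executed ((o, b) :: s.log) d
        · obtain ⟨E, hE, hE'⟩ := enabled_cont hsp hc hready
          have hnil : E = [] := by
            rw [List.eq_nil_iff_forall_not_mem]
            intro d hd
            exact htouch d (by rw [hE]; simp [hd]) (hE' d hd)
          rw [hnil] at hE
          refine Or.inr (Or.inl ⟨o, c, l, hb.tail hc, ?_, ?_⟩)
          · rw [execute_cur_self, hE]; rfl
          · rw [execute_dq_self, hE, h]; rfl
        · exact Or.inl ⟨c, hb.tail hc, late_of_not_ready hc hready⟩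
    · obtain ⟨r', hf'⟩ := exists_isFork hsp
      have hE := enabled_fork hf' (log := (o, b) :: s.log) (executed_cons.2 (Or.inl rfl))
      refine Or.inr (Or.inr (Or.inl ⟨o, r', [], l, hb.tail hf'.2, ?_⟩))
      rw [execute_dq_self, hE, h]; rfl
  · by_cases hop : o = p
    swap
    · exact Or.inr (Or.inr (Or.inl ⟨o, b, l₁, l₂, hb, by rwa [execute_dq_of_ne _ _ hop]⟩))
    subst hop
    -- If nothing is enabled and nothing lies in front of `b`, then `b` is popped and `r` becomes
    -- the bottom. Otherwise the part of the deque from `b` on is unchanged.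
    rcases hE : G.enabled ((o, a) :: s.log) a ++ l₁ with _ | ⟨d, E⟩
    · refine Or.inr (Or.inl ⟨o, b, l₂, hb, ?_, ?_⟩)
      · rw [execute_cur_self, h, ← List.append_assoc, hE]; rfl
      · rw [execute_dq_self, h, ← List.append_assoc, hE]; rfl
    · refine Or.inr (Or.inr (Or.inl ⟨o, b, E, l₂, hb, ?_⟩))
      rw [execute_dq_self, h, ← List.append_assoc, hE]; rfl
  · exact Or.inr (Or.inr (Or.inr ⟨e, he, he', follows_execute h hp⟩))

/-- Executing a fork starts its future thread above the right child. -/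
theorem tracked_fork {s : WSState V P} {v f r : V} (hv : G.IsFork v f r) (p : Fin P) :
    G.Tracked (G.execute s p v) f r := by
  have hE := enabled_fork hv (log := (p, v) :: s.log) (executed_cons.2 (Or.inl rfl))
  refine Or.inr (Or.inl ⟨p, f, s.dq p, Relation.ReflTransGen.refl, ?_, ?_⟩)
  · rw [execute_cur_self, hE]; rfl
  · rw [execute_dq_self, hE]; rfl

section Run

variable {p₀ : Fin P} {σ : Adversary P} {x : ℕ → Fin P}

variable (G) in
/-- The nodes stolen in the first `n` steps. -/
noncomputable def stolen (p₀ : Fin P) (σ : Adversary P) (x : ℕ → Fin P) : ℕ → List V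
  | 0 => []
  | n + 1 => match (G.run p₀ σ x n).cur (σ.sched x n) with
    | none => ((G.run p₀ σ x n).dq (x n)).getLast?.toList ++ stolen p₀ σ x n
    | some _ => stolen p₀ σ x n

theorem stolen_succ_of_none {n : ℕ} (h : (G.run p₀ σ x n).cur (σ.sched x n) = none) :
    G.stolen p₀ σ x (n + 1) =
      ((G.run p₀ σ x n).dq (x n)).getLast?.toList ++ G.stolen p₀ σ x n := by
  simp [stolen, h]

theorem stolen_succ_of_some {n : ℕ} {a : V} (h : (G.run p₀ σ x n).cur (σ.sched x n) = some a) :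
    G.stolen p₀ σ x (n + 1) = G.stolen p₀ σ x n := by
  simp [stolen, h]

theorem stolen_subset_succ (n : ℕ) : G.stolen p₀ σ x n ⊆ G.stolen p₀ σ x (n + 1) := by
  rcases h : (G.run p₀ σ x n).cur (σ.sched x n) with _ | a
  · rw [stolen_succ_of_none h]; exact List.subset_append_right _ _
  · rw [stolen_succ_of_some h]; exact List.Subset.refl _

theorem stolen_mono {k n : ℕ} (h : k ≤ n) : G.stolen p₀ σ x k ⊆ G.stolen p₀ σ x n := by
  induction h with
  | refl => exact List.Subset.refl _
  | step _ ih => exact List.Subset.trans ih (stolen_subset_succ _)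

theorem tracked_run (hG : G.IsSuperFinalSingleTouch) {v f r : V} (hv : G.IsFork v f r) (n : ℕ)
    (hx : Executed (G.run p₀ σ x n).log v) (hr : r ∉ G.stolen p₀ σ x n) :
    G.Tracked (G.run p₀ σ x n) f r := by
  induction n with
  | zero => simp [run, FutureDag.init, Executed] at hx
  | succ n ih =>
    rcases h : (G.run p₀ σ x n).cur (σ.sched x n) with _ | a
    · rw [run_succ_of_none h] at hx ⊢
      rw [stolen_succ_of_none h, List.mem_append, not_or] at hr
      rw [steal_log] at hx
      exact (ih hx hr.2).steal h fun k => hr.1 (by simp [k])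
    · rw [run_succ_of_some h] at hx ⊢
      rw [stolen_succ_of_some h] at hr
      rcases executed_cons.1 hx with rfl | hx
      · exact tracked_fork hv _
      · exact (ih hx hr).execute hG (valid_run p₀ σ x n) hv h

theorem follows_run_spawn {a c : V} (hc : G.spawn a = some c) (n : ℕ)
    (hx : Executed (G.run p₀ σ x n).log a) : (G.run p₀ σ x n).Follows a c := by
  induction n with
  | zero => simp [run, FutureDag.init, Executed] at hx
  | succ n ih =>
    rcases h : (G.run p₀ σ x n).cur (σ.sched x n) with _ | b
    · rw [run_succ_of_none h] at hx ⊢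
      rw [steal_log] at hx
      exact (ih hx).steal h _
    · rw [run_succ_of_some h] at hx ⊢
      rcases executed_cons.1 hx with rfl | hx
      · obtain ⟨r, hr⟩ := exists_isFork hc
        refine follows_of_head ?_
        rw [enabled_fork hr (executed_cons.2 (Or.inl rfl))]; rfl
      · exact follows_execute (ih hx) h

theorem follows_run_cont {a c : V} (hs : G.spawn a = none) (hc : G.cont a = some c) (n : ℕ)
    (hx : Executed (G.run p₀ σ x n).log a) (hl : ¬ G.Late (G.run p₀ σ x n).log c) :
    (G.run p₀ σ x n).Follows a c := by
  induction n with
  | zero => simp [run, FutureDag.init, Executed] at hx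
  | succ n ih =>
    rcases h : (G.run p₀ σ x n).cur (σ.sched x n) with _ | b
    · rw [run_succ_of_none h] at hx hl ⊢
      rw [steal_log] at hx hl
      exact (ih hx hl).steal h _
    · rw [run_succ_of_some h] at hx hl ⊢
      rcases executed_cons.1 hx with rfl | hx
      · by_cases hready : ∀ d, G.Edge d c →
            Executed ((σ.sched x n, a) :: (G.run p₀ σ x n).log) d
        · obtain ⟨E, hE, -⟩ := enabled_cont hs hc hready
          refine follows_of_head ?_
          rw [hE]; rfl
        · exact absurd (late_of_not_ready hc hready) hl
      · exact follows_execute (ih hx fun k => hl (k.cons _)) h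

end Run

end FutureDag

/-! ### Consecutive entries in orders of execution. -/

section ListFacts

variable {V : Type*} {P : ℕ}

theorem eq_of_infix_pair {l : List V} (h : l.Nodup) {a b c : V} (ha : [a, c] <:+: l)
    (hb : [b, c] <:+: l) : a = b := by
  obtain ⟨s, t, rfl⟩ := ha
  obtain ⟨s', t', e⟩ := hb
  have e' : (s' ++ [b]) ++ c :: t' = (s ++ [a]) ++ c :: t := by simpa using e
  have hn : ((s ++ [a]) ++ c :: t).Nodup := by simpa using h
  have hn' : ((s' ++ [b]) ++ c :: t').Nodup := e' ▸ hn
  have key : ∀ {l₁ l₂ l₁' l₂' : List V}, l₁ ++ c :: l₂ = l₁' ++ c :: l₂' → c ∉ l₁ → c ∉ l₁' →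
      l₁ = l₁' := by
    intro l₁ l₂ l₁' l₂' e h1 h2
    induction l₁ generalizing l₁' with
    | nil =>
      rcases l₁' with _ | ⟨d, l₁'⟩
      · rfl
      · simp at e h2; exact absurd e.1 h2.1
    | cons d l₁ ih =>
      rcases l₁' with _ | ⟨d', l₁'⟩
      · simp at e h1; exact absurd e.1.symm h1.1
      · simp only [List.cons_append, List.cons.injEq] at e
        rw [e.1, ih e.2 (fun k => h1 (by simp [k])) (fun k => h2 (by simp [k]))]
  have hnm : ∀ {l₁ l₂ : List V}, (l₁ ++ c :: l₂).Nodup → c ∉ l₁ := by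
    intro l₁ l₂ h k
    exact (List.nodup_append.1 h).2.2 c k c (by simp) rfl
  have := key e' (hnm hn') (hnm hn)
  exact (List.cons.inj (List.append_inj' this rfl).2).1.symm

/-- Of two nodes executed consecutively by a processor, the first is earlier in the log. -/
theorem log_split_of_infix {log : List (Fin P × V)} {p : Fin P} {a c : V}
    (h : [a, c] <:+: procOrder log p) : ∃ l₁ l₂, log = l₁ ++ (p, c) :: l₂ ∧ Executed l₂ a := by
  have h' : [c, a] <:+: (log.filter (fun e => e.1 = p)).map Prod.snd := by
    have := List.reverse_infix.2 h
    simpa [procOrder] using this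
  clear h
  induction log with
  | nil => simp at h'
  | cons e log ih =>
    have lift : [c, a] <:+: (log.filter (fun e => e.1 = p)).map Prod.snd →
        ∃ l₁ l₂, e :: log = l₁ ++ (p, c) :: l₂ ∧ Executed l₂ a := fun k => by
      obtain ⟨l₁, l₂, e', h⟩ := ih k
      exact ⟨e :: l₁, l₂, by rw [e']; rfl, h⟩
    by_cases hp : e.1 = p
    · rw [List.filter_cons_of_pos (by simpa using hp), List.map_cons, List.infix_cons_iff] at h'
      rcases h' with h' | h'
      · rw [List.cons_prefix_cons] at h'
        refine ⟨[], log, by rw [h'.1, ← hp]; rfl, ?_⟩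
        obtain ⟨t, ht⟩ := h'.2
        have : a ∈ (log.filter (fun e => e.1 = p)).map Prod.snd := by rw [← ht]; simp
        obtain ⟨q, hq, hqa⟩ := List.mem_map.1 this
        exact List.mem_map.2 ⟨q, (List.mem_filter.1 hq).1, hqa⟩
      · exact lift h'
    · rw [List.filter_cons_of_neg (by simpa using hp)] at h'
      exact lift h'

end ListFacts

/-! ### Chains of touches and the origin of late touches. -/

namespace FutureDag

variable {V : Type*} {G : FutureDag V} {P : ℕ}

/-- A path ending in a node can be prolonged along a longer path. -/
theorem exists_chain_of_transGen {a b : V} (h : Relation.TransGen G.Edge a b) {l : List V}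
    (hl : l.IsChain G.Edge) (ha : l.getLast? = some a) :
    ∃ l' : List V, l'.IsChain G.Edge ∧ l'.getLast? = some b ∧ l.length < l'.length := by
  have step : ∀ {c d : V} {l : List V}, G.Edge c d → l.IsChain G.Edge → l.getLast? = some c →
      (l ++ [d]).IsChain G.Edge := by
    intro c d l e hl hc
    refine List.isChain_append.2 ⟨hl, List.isChain_singleton d, ?_⟩
    intro x hx y hy
    simp only [List.head?_cons, Option.mem_def, Option.some.injEq] at hy hx
    rw [hc] at hx
    obtain rfl := Option.some.inj hx
    exact hy ▸ e
  induction h with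
  | single e => exact ⟨l ++ [_], step e hl ha, by simp, by simp⟩
  | tail _ e ih =>
    obtain ⟨l', h1, h2, h3⟩ := ih
    exact ⟨l' ++ [_], step e h1 h2, by simp, by simp; omega⟩

variable (G) in
/-- Starting with the touch of the future thread with right child `s`, the touch `y` is reached
after going `i` times from a touch to the touch of the thread in which it lies. -/
def TouchChain (s : V) : ℕ → V → Prop
  | 0, y => ∃ v f, G.IsFork v f s ∧ G.IsTouchOf f y ∧ y ≠ G.final
  | i + 1, y => ∃ y' v f, TouchChain s i y' ∧ G.spawn v = some f ∧ G.InThread f y' ∧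
      G.IsTouchOf f y ∧ y ≠ G.final ∧ Relation.TransGen G.Edge y' y

theorem isTouchOf_unique (hG : G.IsSuperFinalSingleTouch) {v f x y : V} (hv : G.spawn v = some f)
    (hx : G.IsTouchOf f x) (hy : G.IsTouchOf f y) (hx' : x ≠ G.final) (hy' : y ≠ G.final) :
    x = y := by
  obtain ⟨r, hr⟩ := exists_isFork hv
  exact (hG v f r hr.1 hr.2).2.1 x y hx hy hx' hy'

theorem future_unique {v v' f f' y : V} (hv : G.spawn v = some f) (hv' : G.spawn v' = some f')
    (h : G.InThread f y) (h' : G.InThread f' y) : f = f' :=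
  h.unique h' (G.spawn_first hv) (G.spawn_first hv')

/-- Each round is deterministic: a node lies in only one future thread, and this thread has at most
one touch other than the final node. This makes the count in `ncard_late_le` injective. -/
theorem TouchChain.unique (hG : G.IsSuperFinalSingleTouch) {s : V} {i : ℕ} {y z : V}
    (hy : G.TouchChain s i y) (hz : G.TouchChain s i z) : y = z := by
  induction i generalizing y z with
  | zero =>
    obtain ⟨v, f, h1, h2, h3⟩ := hy
    obtain ⟨v', f', h1', h2', h3'⟩ := hz
    have hv := G.cont_inj h1.2 h1'.2
    subst hv
    have hf := Option.some.inj (h1.1.symm.trans h1'.1)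
    subst hf
    exact isTouchOf_unique hG h1.1 h2 h2' h3 h3'
  | succ i ih =>
    obtain ⟨y', v, f, h0, h1, h2, h3, h4, -⟩ := hy
    obtain ⟨z', v', f', h0', h1', h2', h3', h4', -⟩ := hz
    have e := ih h0 h0'
    subst e
    have hf := future_unique h1 h1' h2 h2'
    subst hf
    exact isTouchOf_unique hG h1 h3 h3' h4 h4'

/-- Each round moves strictly forward along edges, and the first touch already ends an edge; hence
`i + 2` nodes. -/
theorem TouchChain.exists_chain {s : V} {i : ℕ} {y : V} (hy : G.TouchChain s i y) :
    ∃ l : List V, l.IsChain G.Edge ∧ l.getLast? = some y ∧ i + 2 ≤ l.length := by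
  induction i generalizing y with
  | zero =>
    obtain ⟨v, f, -, ⟨u, -, hu⟩, -⟩ := hy
    exact ⟨[u, y], by simpa using edge_of_touch hu, rfl, le_rfl⟩
  | succ i ih =>
    obtain ⟨y', v, f, h0, -, -, -, -, h⟩ := hy
    obtain ⟨l, h1, h2, h3⟩ := ih h0
    obtain ⟨l', h1', h2', h3'⟩ := exists_chain_of_transGen h h1 h2
    exact ⟨l', h1', h2', by omega⟩

variable [Fintype V]

theorem TouchChain.lt_span {s : V} {i : ℕ} {y : V} (hy : G.TouchChain s i y) : i < G.span := by
  obtain ⟨l, h1, -, h3⟩ := hy.exists_chain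
  have := le_span h1 (n := l.length - 1) (by omega)
  omega

section Run

variable {p₀ : Fin P} {σ : Adversary P} {x : ℕ → Fin P}

/-- Turns the splitting of the log into an actual state, in which the local parent has been executed
and the future parent has not, so that the invariants of reachable states apply there. -/
theorem exists_time_of_late {n : ℕ} {y : V} (h : G.Late (G.run p₀ σ x n).log y) :
    ∃ k ≤ n, ∃ c w l, (G.run p₀ σ x n).log = l ++ (G.run p₀ σ x k).log ∧ G.cont c = some y ∧
      G.touch w y ∧ Executed (G.run p₀ σ x k).log c ∧ ¬ Executed (G.run p₀ σ x k).log w := by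
  obtain ⟨p, c, w, l₁, l₂, hc, hw, e, hx⟩ := h
  obtain ⟨k, hk, hk'⟩ := exists_run_log_eq e
  refine ⟨k, hk, c, w, l₁, by rw [e, hk'], hc, hw, ?_, ?_⟩
  · rw [hk']; exact executed_cons.2 (Or.inl rfl)
  · rw [hk', executed_cons, not_or]
    refine ⟨?_, hx⟩
    rintro rfl
    exact cont_ne_of_touch hw hc

/-- The source of a delay: a late touch belongs to a future thread whose right child has been stolen
or which contains an earlier late touch. -/
theorem exists_source_of_late (hG : G.IsSuperFinalSingleTouch) {n : ℕ} {y : V}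
    (h : G.Late (G.run p₀ σ x n).log y) (hy : y ≠ G.final) :
    ∃ v f r, G.IsFork v f r ∧ G.IsTouchOf f y ∧ (r ∈ G.stolen p₀ σ x n ∨
      ∃ y', G.InThread f y' ∧ G.Late (G.run p₀ σ x n).log y' ∧
        Relation.TransGen G.Edge y' y) := by
  obtain ⟨k, hk, c, w, l, hl, hc, hw, hxc, hxw⟩ := exists_time_of_late h
  obtain ⟨v, f, hv, hfw, -⟩ := G.touch_source hw
  obtain ⟨r, hr⟩ := exists_isFork hv
  refine ⟨v, f, r, hr, ⟨w, hfw, hw⟩, ?_⟩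
  by_contra! hcon
  have hval := valid_run (G := G) p₀ σ x k
  -- The executed local parent `c` is a descendant of `r`, so at time `k` both `r` and the fork have
  -- been executed and the right child is tracked.
  have hxr := hval.reaches (right_reaches_local hG hr ⟨w, hfw, hw⟩ hy hc) hxc
  have hxv := hval.closed r hxr v hr.edge_right
  have ht := tracked_run hG hr k hxv (fun h => hcon.1 (stolen_mono hk h))
  rcases hval.follows_of_tracked ht hxr with ⟨y', hy', hlate⟩ | ⟨e, he, he', hfol⟩
  · obtain ⟨k', hk', c', w', l', hl', hc', hw', hxc', hxw'⟩ := exists_time_of_late hlate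
    have hxc'' : Executed (G.run p₀ σ x k).log c' := by
      have h2 := List.mem_append_right (l'.map Prod.snd) hxc'
      rwa [← List.map_append, ← hl'] at h2
    -- Both nodes lie in the thread of `f`. If `w` came strictly before `y'`, it would come no later
    -- than the local parent `c'`, which has been executed, while `w` has not.
    have hreach : G.Reaches y' w := by
      have h1 : ¬ G.InThread w y' ∨ w = y' := by
        by_contra! h
        rcases Relation.ReflTransGen.cases_tail h.1 with k1 | ⟨d, hd, hdy⟩
        · exact h.2 k1.symm
        · rw [G.cont_inj hdy hc'] at hd
          exact hxw (hval.reaches (InThread.reaches hd) hxc'')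
      rcases h1 with h1 | h1
      · rcases Relation.ReflTransGen.total_of_right_unique cont_rightUnique hy' hfw with h3 | h3
        · exact InThread.reaches h3
        · exact absurd h3 h1
      · exact h1 ▸ Relation.ReflTransGen.refl
    exact hcon.2 y' hy' (hl ▸ hlate.append l)
      (Relation.TransGen.tail' hreach (edge_of_touch hw))
  -- Otherwise `r` follows the last node of the thread. Then the whole thread has been executed,
  -- including `w`.
  · refine hxw (hval.reaches ?_ hfol.executed)
    rcases Relation.ReflTransGen.total_of_right_unique cont_rightUnique he hfw with h3 | h3
    · rcases Relation.ReflTransGen.cases_head h3 with h3 | ⟨d, hd, -⟩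
      · exact h3 ▸ Relation.ReflTransGen.refl
      · simp [he'] at hd
    · exact InThread.reaches h3

/-- Well-founded descent along `exists_source_of_late`: the earlier late touch lies in a future
thread, so it is not the final node, and the search ends only at a stolen right child. -/
theorem exists_touchChain (hG : G.IsSuperFinalSingleTouch) {n : ℕ} {y : V}
    (h : G.Late (G.run p₀ σ x n).log y) (hy : y ≠ G.final) :
    ∃ s ∈ G.stolen p₀ σ x n, ∃ i, G.TouchChain s i y := by
  induction y using (wellFounded_transGen (G := G)).induction with
  | _ y ih =>
    obtain ⟨v, f, r, hv, hfy, hr | ⟨y', hy', hl, ht⟩⟩ := exists_source_of_late hG h hy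
    · exact ⟨r, hr, 0, v, f, hv, hfy, hy⟩
    · obtain ⟨s, hs, i, hi⟩ := ih y' ht hl (ne_final_of_inThread hv.1 hy')
      exact ⟨s, hs, i + 1, y', v, f, hi, hv.1, hy', hfy, hy, ht⟩

/-- Without steals no touch is late. -/
theorem not_late_of_stolen_eq_nil (hG : G.IsSuperFinalSingleTouch) {n : ℕ}
    (hn : G.stolen p₀ σ x n = []) (y : V) : ¬ G.Late (G.run p₀ σ x n).log y := by
  intro h
  by_cases hy : y = G.final
  swap
  · obtain ⟨s, hs, -⟩ := exists_touchChain hG h hy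
    simp [hn] at hs
  subst hy
  obtain ⟨k, hk, c, w, l, hl, hc, hw, hxc, hxw⟩ := exists_time_of_late h
  have hval := valid_run (G := G) p₀ σ x k
  have hk0 : G.stolen p₀ σ x k = [] := by
    have := stolen_mono (G := G) (p₀ := p₀) (σ := σ) (x := x) hk
    rw [hn] at this
    exact List.eq_nil_of_subset_nil this
  have hmain : ∀ a, G.InThread G.root a → a ≠ G.final → Executed (G.run p₀ σ x k).log a := by
    intro a ha ha'
    rcases Relation.ReflTransGen.cases_tail (inThread_final_of_main ha) with k1 | ⟨d, hd, hdf⟩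
    · exact absurd k1.symm ha'
    · rw [G.cont_inj hdf hc] at hd
      exact hval.reaches (InThread.reaches hd) hxc
  -- The final node needs its own argument, since its local parent need not be a descendant of a
  -- given right child. Once the main thread is complete up to the final node, induction on the fork
  -- shows that every future thread has ended: the thread containing the fork has been executed
  -- beyond `r`, and `r` follows the last node of the future thread.
  have key : ∀ v f, G.spawn v = some f → ∀ e, G.InThread f e → G.cont e = none →
      Executed (G.run p₀ σ x k).log e := by
    intro v
    induction v using (wellFounded_transGen (G := G)).induction with
    | _ v ih =>
      intro f hv e he he'
      obtain ⟨r, hr⟩ := exists_isFork hv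
      have hxr : Executed (G.run p₀ σ x k).log r := by
        rcases mem_main_or_future (G := G) v with hm | ⟨v', f', hv', hf'⟩
        · exact hmain r (hm.tail hr.2) fun k1 => hr.not_touch_right w (k1 ▸ hw)
        · obtain ⟨e', h1, h2⟩ := exists_thread_end (G := G) r
          have h3 : G.InThread f' e' := Relation.ReflTransGen.trans (hf'.tail hr.2) h1
          exact hval.reaches (InThread.reaches h1)
            (ih v' (Relation.TransGen.head' (edge_of_spawn hv') (InThread.reaches hf'))
              f' hv' e' h3 h2)
      have hxv := hval.closed r hxr v hr.edge_right
      rcases hval.follows_of_tracked (tracked_run hG hr k hxv (by simp [hk0])) hxr with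
        ⟨y, hy, hlate⟩ | ⟨e', h1, h2, h3⟩
      · obtain ⟨s, hs, -⟩ := exists_touchChain hG hlate (ne_final_of_inThread hv hy)
        simp [hk0] at hs
      · rw [he.end_unique h1 he' h2]
        exact h3.executed
  obtain ⟨v, f, hv, hfw, -⟩ := G.touch_source hw
  exact hxw (key v f hv w hfw (G.touch_final hw))

theorem root_not_second (n : ℕ) (p : Fin P) (a : V) :
    ¬ [a, G.root] <:+: procOrder (G.run p₀ σ x n).log p := by
  intro h
  obtain ⟨l₁, l₂, e, ha⟩ := log_split_of_infix h
  obtain ⟨k, -, hk⟩ := exists_run_log_eq (l₁ := l₁ ++ [(p, G.root)]) (l₂ := l₂) (by simpa using e)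
  have := (valid_run (G := G) p₀ σ x k).reaches (root_reaches a) (hk ▸ ha)
  rw [hk] at this
  have hnd := (valid_run (G := G) p₀ σ x n).log_nodup
  rw [e, List.map_append, List.map_cons, List.nodup_append, List.nodup_cons] at hnd
  exact hnd.2.1.1 this

end Run

/-! ### The sequential execution -/

section Sequential

variable {σ : Adversary 1} {x : ℕ → Fin 1}

theorem stolen_seq (n : ℕ) : G.stolen 0 σ x n = [] := by
  induction n with
  | zero => rfl
  | succ n ih =>
    rcases h : (G.run 0 σ x n).cur (σ.sched x n) with _ | a
    · rw [stolen_succ_of_none h, ih, Subsingleton.elim (x n) (σ.sched x n),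
        (valid_run (P := 1) 0 σ x n).idle _ h]
      rfl
    · rw [stolen_succ_of_some h, ih]

theorem executed_run_succ {p₀ : Fin P} {σ : Adversary P} {x : ℕ → Fin P} {n : ℕ} {a : V}
    (h : Executed (G.run p₀ σ x n).log a) : Executed (G.run p₀ σ x (n + 1)).log a := by
  rcases hc : (G.run p₀ σ x n).cur (σ.sched x n) with _ | b
  · rwa [run_succ_of_none hc, steal_log]
  · rw [run_succ_of_some hc]
    exact h.cons _

/-- A single processor executes a node in each step unless it holds nothing. In that case no
unexecuted node is ready, and by induction along edges all nodes have been executed. -/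
theorem seq_length_or_executed (n : ℕ) : (G.run 0 σ x n).log.length = n ∨
    ∀ v, Executed (G.run 0 σ x n).log v := by
  induction n with
  | zero => exact Or.inl rfl
  | succ n ih =>
    rcases ih with ih | ih
    · rcases hc : (G.run 0 σ x n).cur (σ.sched x n) with _ | b
      · refine Or.inr fun v => executed_run_succ ?_
        have hval := valid_run (G := G) (P := 1) 0 σ x n
        induction v using (wellFounded_edge (G := G)).induction with
        | _ v ih' =>
          by_contra hv
          obtain ⟨p, hp⟩ := hval.live v hv fun d hd => ih' d hd
          rw [Subsingleton.elim p (σ.sched x n)] at hp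
          simp [WSState.held, hc, hval.idle _ hc] at hp
      · left
        rw [run_succ_of_some hc, execute_log, List.length_cons, ih]
    · exact Or.inr fun v => executed_run_succ (ih v)

theorem mem_seqOrder (v : V) : v ∈ G.seqOrder := by
  classical
  have : Executed (G.run (P := 1) 0 (fun _ _ => 0) (fun _ => 0) (Fintype.card V)).log v := by
    rcases seq_length_or_executed (G := G) (σ := fun _ _ => 0) (x := fun _ => 0)
      (Fintype.card V) with h | h
    · have hnd :=
        (valid_run (G := G) (P := 1) 0 (fun _ _ => 0) (fun _ => 0) (Fintype.card V)).log_nodup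
      have := Finset.eq_univ_of_card _ ((List.toFinset_card_of_nodup hnd).trans
        ((List.length_map _).trans h))
      have h2 := Finset.mem_univ v
      rw [← this, List.mem_toFinset] at h2
      exact h2
    · exact h v
  obtain ⟨p, hp⟩ := executed_iff_exists.1 this
  rwa [Subsingleton.elim p 0] at hp

theorem seqOrder_nodup : G.seqOrder.Nodup :=
  procOrder_nodup (valid_run (P := 1) 0 _ _ _).log_nodup 0

variable (G) in
/-- The immediate predecessor of `c` in the sequential execution: the fork of a future thread, the
preceding node in the thread, or the last node of the future thread if `c` is a right child. -/
theorem seqOrder_pred (hG : G.IsSuperFinalSingleTouch) {c : V} (hc : c ≠ G.root) :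
    ∃ a, [a, c] <:+: G.seqOrder ∧ (G.spawn a = some c ∨ (G.spawn a = none ∧ G.cont a = some c) ∨
      ∃ v f, G.IsFork v f c ∧ G.InThread f a ∧ G.cont a = none) := by
  set σ : Adversary 1 := fun _ _ => 0 with hσ
  set x : ℕ → Fin 1 := fun _ => 0 with hx
  set N := Fintype.card V with hN
  have hval := valid_run (G := G) (P := 1) 0 σ x N
  have hex : ∀ v, Executed (G.run 0 σ x N).log v := fun v =>
    executed_iff_exists.2 ⟨0, mem_seqOrder v⟩
  have hlate := not_late_of_stolen_eq_nil hG (stolen_seq (G := G) (σ := σ) (x := x) N)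
  have hinf : ∀ a, (G.run 0 σ x N).Follows a c → [a, c] <:+: G.seqOrder := by
    intro a h
    obtain ⟨p, hp⟩ := hval.infix_of_follows h (hex c)
    rwa [Subsingleton.elim p 0] at hp
  rcases G.has_parent c hc with ⟨a, ha⟩ | ⟨a, ha⟩
  · rcases hs : G.spawn a with _ | f
    · exact ⟨a, hinf a (follows_run_cont hs ha N (hex a) (hlate c)), Or.inr (Or.inl ⟨hs, ha⟩)⟩
    · have hv : G.IsFork a f c := ⟨hs, ha⟩
      have ht := tracked_run (p₀ := 0) (σ := σ) (x := x) hG hv N (hex a) (by simp [stolen_seq])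
      rcases hval.follows_of_tracked ht (hex c) with ⟨y, -, hy⟩ | ⟨e, he, he', h⟩
      · exact absurd hy (hlate y)
      · exact ⟨e, hinf e h, Or.inr (Or.inr ⟨a, f, hv, he, he'⟩)⟩
  · exact ⟨a, hinf a (follows_run_spawn ha N (hex a)), Or.inl ha⟩

end Sequential

/-! ### The number of deviations -/

section Deviations

variable {p₀ : Fin P} {σ : Adversary P} {x : ℕ → Fin P}

theorem IsDeviation.ne_root {n : ℕ} {v : V} (h : G.IsDeviation (G.run p₀ σ x n).log v) :
    v ≠ G.root := by
  rintro rfl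
  obtain ⟨-, a, ha, -⟩ := h
  exact root_not_second _ _ a ha

/-- Every deviation is a late touch, or the right child of a fork that has been stolen or whose
future thread contains a late touch. -/
theorem IsDeviation.cases (hG : G.IsSuperFinalSingleTouch) {n : ℕ} {v : V}
    (h : G.IsDeviation (G.run p₀ σ x n).log v) : G.Late (G.run p₀ σ x n).log v ∨
      ∃ u f, G.IsFork u f v ∧ (v ∈ G.stolen p₀ σ x n ∨
        ∃ y, G.InThread f y ∧ G.Late (G.run p₀ σ x n).log y) := by
  obtain ⟨a, ha, hcase⟩ := seqOrder_pred G hG h.ne_root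
  obtain ⟨hxv, a', ha', hno⟩ := h
  obtain rfl := eq_of_infix_pair seqOrder_nodup ha ha'
  have hval := valid_run (G := G) p₀ σ x n
  have hfol : ¬ (G.run p₀ σ x n).Follows a v := fun h => by
    obtain ⟨p, hp⟩ := hval.infix_of_follows h hxv
    exact hno p hp
  rcases hcase with hc | ⟨hs, hc⟩ | ⟨u, f, hu, hfa, hca⟩
  · exact absurd (follows_run_spawn hc n (hval.closed v hxv a (edge_of_spawn hc))) hfol
  · by_contra! hcon
    exact hfol (follows_run_cont hs hc n (hval.closed v hxv a (edge_of_cont hc)) hcon.1)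
  · refine Or.inr ⟨u, f, hu, ?_⟩
    by_contra! hcon
    have ht := tracked_run hG hu n (hval.closed v hxv u hu.edge_right) hcon.1
    rcases hval.follows_of_tracked ht hxv with ⟨y, hy, hl⟩ | ⟨e, he, he', h⟩
    · exact hcon.2 y hy hl
    · rw [he.end_unique hfa he' hca] at h
      exact hfol h

/-- A late touch is encoded by a stolen node and a number of rounds less than the span;
`TouchChain.unique` decodes it. -/
theorem ncard_late_le (hG : G.IsSuperFinalSingleTouch) (n : ℕ) :
    {y | G.Late (G.run p₀ σ x n).log y ∧ y ≠ G.final}.ncard ≤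
      (G.stolen p₀ σ x n).length * G.span := by
  classical
  choose! s hs i hi using fun (y : V) (hy : G.Late (G.run p₀ σ x n).log y ∧ y ≠ G.final) =>
    exists_touchChain hG hy.1 hy.2
  rw [Set.ncard_eq_toFinset_card']
  calc _ ≤ ((G.stolen p₀ σ x n).toFinset ×ˢ Finset.range G.span).card := by
        refine Finset.card_le_card_of_injOn (fun y => (s y, i y)) ?_ ?_
        · intro y hy
          have hy : G.Late (G.run p₀ σ x n).log y ∧ y ≠ G.final := by simpa using hy
          simpa using ⟨hs y hy, (hi y hy).lt_span⟩
        · intro y hy z hz e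
          have hy : G.Late (G.run p₀ σ x n).log y ∧ y ≠ G.final := by simpa using hy
          have hz : G.Late (G.run p₀ σ x n).log z ∧ z ≠ G.final := by simpa using hz
          simp only [Prod.mk.injEq] at e
          have h1 := hi y hy
          rw [e.1, e.2] at h1
          exact h1.unique hG (hi z hz)
    _ ≤ _ := by
        rw [Finset.card_product, Finset.card_range]
        exact Nat.mul_le_mul_right _ (List.toFinset_card_le _)

/-- The number of deviations is at most proportional to the number of steals times the span. -/
theorem ncard_deviation_le (hG : G.IsSuperFinalSingleTouch) (n : ℕ) :
    {v | G.IsDeviation (G.run p₀ σ x n).log v}.ncard ≤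
      4 * G.span * (G.stolen p₀ σ x n).length := by
  classical
  rcases Set.eq_empty_or_nonempty {v | G.IsDeviation (G.run p₀ σ x n).log v} with h0 | ⟨v₀, hv₀⟩
  · rw [h0, Set.ncard_empty]; exact Nat.zero_le _
  have hspan : 1 ≤ G.span := by
    rcases G.has_parent v₀ (IsDeviation.ne_root hv₀) with ⟨a, ha⟩ | ⟨a, ha⟩
    exacts [(edge_of_cont ha).one_le_span, (edge_of_spawn ha).one_le_span]
  have hst : G.stolen p₀ σ x n ≠ [] := by
    intro hst
    have hl := not_late_of_stolen_eq_nil hG hst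
    rcases IsDeviation.cases hG hv₀ with h | ⟨u, f, -, h | ⟨y, -, h⟩⟩
    · exact hl _ h
    · simp [hst] at h
    · exact hl _ h
  set L := {y | G.Late (G.run p₀ σ x n).log y ∧ y ≠ G.final} with hL
  set R := {r | ∃ u f, G.IsFork u f r ∧ ∃ y ∈ L, G.InThread f y} with hR
  set S : Set V := {r | r ∈ G.stolen p₀ σ x n} with hS
  have hsub : {v | G.IsDeviation (G.run p₀ σ x n).log v} ⊆ ((L ∪ R) ∪ S) ∪ {G.final} := by
    intro v hv
    rcases IsDeviation.cases hG hv with h | ⟨u, f, hu, h | ⟨y, hy, h⟩⟩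
    · by_cases hvf : v = G.final
      · exact Or.inr hvf
      · exact Or.inl (Or.inl (Or.inl ⟨h, hvf⟩))
    · exact Or.inl (Or.inr h)
    · exact Or.inl (Or.inl (Or.inr ⟨u, f, hu, y, ⟨h, ne_final_of_inThread hu.1 hy⟩, hy⟩))
  have hLc : L.ncard ≤ (G.stolen p₀ σ x n).length * G.span := ncard_late_le hG n
  -- A late touch lies in one future thread only, which determines the fork and its right child.
  have hRc : R.ncard ≤ L.ncard := by
    choose! u f hu y hy hfy using fun (r : V) (hr : r ∈ R) => hr
    refine Set.ncard_le_ncard_of_injOn y (fun r hr => hy r hr) ?_ (Set.toFinite _)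
    intro r hr r' hr' e
    have h1 := hfy r hr
    have h2 := hfy r' hr'
    rw [e] at h1
    have hf := future_unique (hu r hr).1 (hu r' hr').1 h1 h2
    have huu := G.spawn_inj (hf ▸ (hu r hr).1) (hu r' hr').1
    exact Option.some.inj ((hu r hr).2.symm.trans (huu ▸ (hu r' hr').2))
  have hSc : S.ncard ≤ (G.stolen p₀ σ x n).length := by
    have : S = ((G.stolen p₀ σ x n).toFinset : Set V) := by ext; simp [hS]
    rw [this, Set.ncard_coe_finset]
    exact List.toFinset_card_le _
  have hpos : 1 ≤ (G.stolen p₀ σ x n).length := List.length_pos_iff.2 hst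
  calc _ ≤ (((L ∪ R) ∪ S) ∪ {G.final}).ncard := Set.ncard_le_ncard hsub (Set.toFinite _)
    _ ≤ L.ncard + R.ncard + S.ncard + 1 := by
        refine (Set.ncard_union_le _ _).trans ?_
        rw [Set.ncard_singleton]
        have h1 := Set.ncard_union_le (L ∪ R) S
        have h2 := Set.ncard_union_le L R
        omega
    -- With `m` steals, each of the four terms is at most `m * span`; the terms for stolen nodes and
    -- for the final node need `1 ≤ span` and `1 ≤ m`, which hold as soon as there is a deviation.
    _ ≤ _ := by nlinarith

end Deviations

end FutureDag

/-! ### Comparison of LRU caches. -/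

section LRU

variable {B : Type*}

open scoped Classical in
/-- The contents of the cache after a sequence of accesses. -/
noncomputable def lruState (C : ℕ) : List B → List B → List B
  | cache, [] => cache
  | cache, m :: ms => lruState C ((m :: cache.erase m).take C) ms

theorem lruState_append (C : ℕ) (c l l' : List B) :
    lruState C c (l ++ l') = lruState C (lruState C c l) l' := by
  induction l generalizing c with
  | nil => rfl
  | cons m l ih => exact ih _

theorem lruMisses_append (C : ℕ) (c l l' : List B) :
    lruMisses C c (l ++ l') = lruMisses C c l + lruMisses C (lruState C c l) l' := by
  induction l generalizing c with
  | nil => simp [lruMisses, lruState]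
  | cons m l ih => simp only [List.cons_append, lruMisses, lruState, ih, add_assoc]

theorem length_lruState_le (C : ℕ) {c : List B} (hc : c.length ≤ C) (l : List B) :
    (lruState C c l).length ≤ C := by
  induction l generalizing c with
  | nil => exact hc
  | cons m l ih => exact ih (List.length_take_le _ _)

/-- Two caches agree on their most recently used blocks, except for at most `d` blocks. -/
def LruClose (C d : ℕ) (c c' : List B) : Prop :=
  c.length ≤ C ∧ c'.length ≤ C ∧
    (c = c' ∨ ∃ s t t', c = s ++ t ∧ c' = s ++ t' ∧ C ≤ d + s.length)

theorem LruClose.refl {C : ℕ} {c : List B} (h : c.length ≤ C) : LruClose C 0 c c :=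
  ⟨h, h, Or.inl rfl⟩

theorem LruClose.of_length_le {C : ℕ} {c c' : List B} (h : c.length ≤ C) (h' : c'.length ≤ C) :
    LruClose C C c c' :=
  ⟨h, h', Or.inr ⟨[], c, c', rfl, rfl, by simp⟩⟩

-- The number `d` is a credit for future extra misses. An access inside the common prefix `s` hits
-- in both caches. Any other access lengthens the prefix by one block, so one unit of credit pays
-- for a possible extra miss; once the prefix fills the cache, the two caches are equal.
open scoped Classical in
theorem LruClose.access {C d : ℕ} {c c' : List B} (h : LruClose C d c c') (m : B) :
    ∃ d', LruClose C d' ((m :: c.erase m).take C) ((m :: c'.erase m).take C) ∧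
      (if m ∈ c then 0 else 1) + d' ≤ (if m ∈ c' then 0 else 1) + d := by
  have hl : ∀ c : List B, ((m :: c.erase m).take C).length ≤ C := fun _ => List.length_take_le _ _
  obtain ⟨h1, h2, rfl | ⟨s, t, t', rfl, rfl, hd⟩⟩ := h
  · exact ⟨d, ⟨hl _, hl _, Or.inl rfl⟩, le_rfl⟩
  by_cases hm : m ∈ s
  · have key : ∀ t : List B, (s ++ t).length ≤ C →
        (m :: (s ++ t).erase m).take C = (m :: s.erase m) ++ t := by
      intro t ht
      have hpos := List.length_pos_of_mem hm
      rw [List.erase_append_left _ hm, ← List.cons_append, List.take_of_length_le]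
      simp only [List.length_append, List.length_cons, List.length_erase_of_mem hm] at ht ⊢
      omega
    refine ⟨d, ⟨hl _, hl _, Or.inr ⟨m :: s.erase m, t, t', key t h1, key t' h2, ?_⟩⟩, ?_⟩
    · have hpos := List.length_pos_of_mem hm
      simp only [List.length_cons, List.length_erase_of_mem hm]
      omega
    · simp [hm]
  · by_cases hC : C ≤ s.length
    · have ht : t = [] := by
        rw [← List.length_eq_zero_iff]; simp only [List.length_append] at h1; omega
      have ht' : t' = [] := by
        rw [← List.length_eq_zero_iff]; simp only [List.length_append] at h2; omega
      subst ht ht'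
      exact ⟨d, ⟨hl _, hl _, Or.inl rfl⟩, le_rfl⟩
    · have key : ∀ t : List B, ∃ t₂, (m :: (s ++ t).erase m).take C = (m :: s) ++ t₂ := by
        intro t
        rw [List.erase_append_right _ hm, ← List.cons_append, List.take_append,
          List.take_of_length_le (by simp; omega)]
        exact ⟨_, rfl⟩
      obtain ⟨t₂, ht₂⟩ := key t
      obtain ⟨t₂', ht₂'⟩ := key t'
      refine ⟨d - 1, ⟨hl _, hl _, Or.inr ⟨m :: s, t₂, t₂', ht₂, ht₂', ?_⟩⟩, ?_⟩
      · simp only [List.length_cons]; omega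
      · split_ifs <;> omega

theorem LruClose.accesses {C d : ℕ} {c c' : List B} (h : LruClose C d c c') (l : List B) :
    ∃ d', LruClose C d' (lruState C c l) (lruState C c' l) ∧
      lruMisses C c l + d' ≤ lruMisses C c' l + d := by
  induction l generalizing c c' d with
  | nil => exact ⟨d, h, by simp [lruMisses]⟩
  | cons m l ih =>
    obtain ⟨d₁, h₁, e₁⟩ := h.access m
    obtain ⟨d₂, h₂, e₂⟩ := ih h₁
    refine ⟨d₂, h₂, ?_⟩
    simp only [lruMisses]
    omega

variable {V : Type*}

open scoped Classical in
/-- The cache before the task `v`, when the tasks are executed in the order `S`. -/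
noncomputable def cacheBefore (C : ℕ) (acc : V → List B) (S : List V) (v : V) : List B :=
  lruState C [] ((S.takeWhile (fun w => w ≠ v)).flatMap acc)

/-- The number of misses of the task `v`, when the tasks are executed in the order `S`. -/
noncomputable def taskMisses (C : ℕ) (acc : V → List B) (S : List V) (v : V) : ℕ :=
  lruMisses C (cacheBefore C acc S v) (acc v)

theorem length_cacheBefore_le (C : ℕ) (acc : V → List B) (S : List V) (v : V) :
    (cacheBefore C acc S v).length ≤ C := length_lruState_le C (by simp) _

theorem cacheBefore_append_cons (C : ℕ) (acc : V → List B) {l : List V} (l' : List V) {v : V}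
    (h : v ∉ l) : cacheBefore C acc (l ++ v :: l') v = lruState C [] (l.flatMap acc) := by
  classical
  unfold cacheBefore
  congr 2
  rw [List.takeWhile_append_of_pos, List.takeWhile_cons_of_neg, List.append_nil]
  · simp
  · intro w hw
    have : w ≠ v := by rintro rfl; exact h hw
    simpa using this

theorem notMem_of_nodup_append_cons {l l' : List V} {v : V} (h : (l ++ v :: l').Nodup) :
    v ∉ l := fun k => (List.nodup_append.1 h).2.2 v k v (by simp) rfl

theorem cacheBefore_of_infix (C : ℕ) (acc : V → List B) {S : List V} (hS : S.Nodup) {a v : V}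
    (h : [a, v] <:+: S) : cacheBefore C acc S v = lruState C (cacheBefore C acc S a) (acc a) := by
  obtain ⟨l, l', rfl⟩ := h
  have e : l ++ [a, v] ++ l' = (l ++ [a]) ++ v :: l' := by simp
  have e' : l ++ [a, v] ++ l' = l ++ a :: (v :: l') := by simp
  have h1 := cacheBefore_append_cons C acc l' (notMem_of_nodup_append_cons (e ▸ hS))
  have h2 := cacheBefore_append_cons C acc (v :: l') (notMem_of_nodup_append_cons (e' ▸ hS))
  rw [← e] at h1
  rw [← e'] at h2
  rw [h1, h2, List.flatMap_append, lruState_append]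
  simp

theorem sum_taskMisses (C : ℕ) (acc : V → List B) (l l' : List V) (h : (l ++ l').Nodup) :
    lruMisses C (lruState C [] (l.flatMap acc)) (l'.flatMap acc) =
      (l'.map (taskMisses C acc (l ++ l'))).sum := by
  induction l' generalizing l with
  | nil => simp [lruMisses]
  | cons v l' ih =>
    have h1 := cacheBefore_append_cons C acc l' (notMem_of_nodup_append_cons h)
    have e : l ++ v :: l' = (l ++ [v]) ++ l' := by simp
    have h2 := ih (l ++ [v]) (e ▸ h)
    rw [← e, List.flatMap_append, lruState_append] at h2
    simp only [List.flatMap_cons, List.flatMap_nil, List.append_nil] at h2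
    rw [List.flatMap_cons, lruMisses_append, h2, List.map_cons, List.sum_cons, taskMisses, h1]

-- As long as `L` follows `S`, the cache before the next task in `S` is the one just compared with,
-- so the credit `d` carries over. At a task in `D` the comparison restarts with fresh credit `C`,
-- as any two caches are `C`-close.
open scoped Classical in
theorem lruMisses_cons_le (C : ℕ) (acc : V → List B) {S : List V} (hS : S.Nodup)
    (D : V → Prop) (L : List V) (a : V)
    (h : ∀ b v, [b, v] <:+: a :: L → D v ∨ [b, v] <:+: S) {d : ℕ} {c : List B}
    (hc : LruClose C d c (cacheBefore C acc S a)) :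
    lruMisses C c ((a :: L).flatMap acc) ≤ taskMisses C acc S a + d +
      (L.map (fun v => taskMisses C acc S v + C * if D v then 1 else 0)).sum := by
  induction L generalizing a c d with
  | nil =>
    obtain ⟨d', -, h'⟩ := hc.accesses (acc a)
    simp only [List.flatMap_cons, List.flatMap_nil, List.append_nil, List.map_nil, List.sum_nil,
      taskMisses]
    omega
  | cons v L ih =>
    obtain ⟨d', hcl, h'⟩ := hc.accesses (acc a)
    have hrec : ∀ b w, [b, w] <:+: v :: L → D w ∨ [b, w] <:+: S := fun b w k =>
      h b w (k.trans (List.suffix_cons a _).isInfix)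
    rw [List.flatMap_cons, lruMisses_append, List.map_cons, List.sum_cons]
    by_cases hv : D v
    · have := ih v hrec (LruClose.of_length_le hcl.1 (length_cacheBefore_le C acc S v))
      simp only [hv, if_true, taskMisses] at this ⊢
      omega
    · have hav := (h a v ⟨[], L, by simp⟩).resolve_left hv
      rw [← cacheBefore_of_infix C acc hS hav] at hcl
      have := ih v hrec hcl
      simp only [hv, if_false, taskMisses] at this ⊢
      omega

open scoped Classical in
theorem lruMisses_le (C : ℕ) (acc : V → List B) {S : List V} (hS : S.Nodup)
    (D : V → Prop) (L : List V) (h : ∀ b v, [b, v] <:+: L → D v ∨ [b, v] <:+: S)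
    (h0 : ∀ a, L.head? = some a → D a ∨ S.head? = some a) :
    lruMisses C [] (L.flatMap acc) ≤
      (L.map (fun v => taskMisses C acc S v + C * if D v then 1 else 0)).sum := by
  rcases L with _ | ⟨a, L⟩
  · simp [lruMisses]
  rw [List.map_cons, List.sum_cons]
  by_cases ha : D a
  · have := lruMisses_cons_le C acc hS D L a h (LruClose.of_length_le (C := C) (c := []) (by simp)
      (length_cacheBefore_le C acc S a))
    simp only [ha, if_true]
    omega
  -- A first task outside `D` is also the first of `S`, so both caches are empty and no credit is
  -- needed.
  · have h1 := (h0 a rfl).resolve_left ha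
    obtain ⟨l, rfl⟩ : ∃ l, S = a :: l := by
      rcases S with _ | ⟨b, l⟩
      · simp at h1
      · exact ⟨l, by simpa using h1⟩
    have hnil : cacheBefore C acc (a :: l) a = [] :=
      cacheBefore_append_cons C acc (l := []) l (by simp)
    have := lruMisses_cons_le C acc hS D L a h (d := 0) (c := [])
      (by rw [hnil]; exact LruClose.refl (by simp))
    simp only [ha, if_false]
    omega

end LRU

theorem sum_procOrder {V : Type*} {P : ℕ} (log : List (Fin P × V)) (g : V → ℕ) :
    ∑ p, ((procOrder log p).map g).sum = ((log.map Prod.snd).map g).sum := by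
  induction log with
  | nil => simp [procOrder]
  | cons e log ih =>
    obtain ⟨q, a⟩ := e
    have : ∀ p, ((procOrder ((q, a) :: log) p).map g).sum =
        ((procOrder log p).map g).sum + if q = p then g a else 0 := by
      intro p
      by_cases hp : q = p
      · subst hp; simp [procOrder_cons_self]
      · simp [procOrder_cons_of_ne _ _ hp, hp]
    simp [this, Finset.sum_add_distrib, ih, add_comm]

/-! ### Deviations pay for the additional misses. -/

namespace FutureDag

variable {V : Type*} {G : FutureDag V} {P : ℕ}

theorem Valid.proc_unique {s : WSState V P} (h : G.Valid s) {p q : Fin P} {a : V}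
    (hp : a ∈ procOrder s.log p) (hq : a ∈ procOrder s.log q) : p = q := by
  rw [mem_procOrder] at hp hq
  have := List.inj_on_of_nodup_map h.log_nodup hp hq rfl
  exact (Prod.mk.inj this).1

theorem not_infix_head {l : List V} (hl : l.Nodup) {a b : V} (h : l.head? = some a) :
    ¬ [b, a] <:+: l := by
  rintro ⟨s, t, rfl⟩
  have e : s ++ [b, a] ++ t = (s ++ [b]) ++ a :: t := by simp
  rw [e] at hl h
  have h1 := notMem_of_nodup_append_cons hl
  rcases s with _ | ⟨c, s⟩
  · simp at h h1; exact h1 h.symm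
  · simp at h h1; exact h1.1 h.symm

variable [Fintype V] {B : Type*}
variable {p₀ : Fin P} {σ : Adversary P} {x : ℕ → Fin P}

theorem seqOrder_head (hG : G.IsSuperFinalSingleTouch) : G.seqOrder.head? = some G.root := by
  rcases h : G.seqOrder.head? with _ | a
  · rw [List.head?_eq_none_iff] at h
    have := mem_seqOrder (G := G) G.root
    simp [h] at this
  · by_contra hne
    obtain ⟨b, hb, -⟩ := seqOrder_pred G hG (c := a) (fun e => hne (e ▸ rfl))
    exact not_infix_head seqOrder_nodup h hb

/-- Each deviation costs at most `C` additional misses. -/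
theorem misses_le (hG : G.IsSuperFinalSingleTouch) (C : ℕ) (acc : V → List B) (n : ℕ) :
    ∑ p, lruMisses C [] ((procOrder (G.run p₀ σ x n).log p).flatMap acc) ≤
      G.seqMisses C acc + C * {v | G.IsDeviation (G.run p₀ σ x n).log v}.ncard := by
  classical
  have hval := valid_run (G := G) p₀ σ x n
  set log := (G.run p₀ σ x n).log with hlog
  set g : V → ℕ := fun v => taskMisses C acc G.seqOrder v +
    C * if G.IsDeviation log v then 1 else 0 with hg
  have hnd := fun p => procOrder_nodup hval.log_nodup p
  have hproc : ∀ p, lruMisses C [] ((procOrder log p).flatMap acc) ≤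
      ((procOrder log p).map g).sum := by
    intro p
    -- A node that is no deviation is executed by some processor right after its sequential
    -- predecessor. That processor is `p`, because a node is executed only once.
    have key : ∀ v, v ∈ procOrder log p → v ≠ G.root → G.IsDeviation log v ∨
        ∃ a, [a, v] <:+: G.seqOrder ∧ [a, v] <:+: procOrder log p := by
      intro v hv hvr
      by_contra! hcon
      obtain ⟨a, ha, -⟩ := seqOrder_pred G hG hvr
      refine hcon.1 ⟨executed_iff_exists.2 ⟨p, hv⟩, a, ha, fun q hq => hcon.2 a ha ?_⟩
      rwa [hval.proc_unique hv (hq.subset (by simp))]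
    refine lruMisses_le C acc seqOrder_nodup _ _ (fun b v hbv => ?_) (fun a ha => ?_)
    · rcases key v (hbv.subset (by simp)) (fun e => root_not_second n p b (e ▸ hbv)) with
        h | ⟨a, ha, ha'⟩
      · exact Or.inl h
      · exact Or.inr (eq_of_infix_pair (hnd p) ha' hbv ▸ ha)
    · by_cases har : a = G.root
      · exact Or.inr (har ▸ seqOrder_head hG)
      · rcases key a (List.mem_of_head? ha) har with h | ⟨b, -, hb⟩
        · exact Or.inl h
        · exact absurd hb (not_infix_head (hnd p) ha)
  have hseq : G.seqMisses C acc = ∑ v, taskMisses C acc G.seqOrder v := by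
    have h1 := sum_taskMisses C acc [] G.seqOrder (by simpa using seqOrder_nodup)
    simp only [List.flatMap_nil, List.nil_append] at h1
    have h2 : G.seqOrder.toFinset = Finset.univ :=
      Finset.eq_univ_iff_forall.2 fun v => List.mem_toFinset.2 (mem_seqOrder v)
    rw [seqMisses, ← h2, List.sum_toFinset _ seqOrder_nodup]
    exact h1
  calc _ ≤ ∑ p, ((procOrder log p).map g).sum := Finset.sum_le_sum fun p _ => hproc p
    _ = ∑ v ∈ (log.map Prod.snd).toFinset, g v := by
        rw [sum_procOrder, List.sum_toFinset _ hval.log_nodup]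
    _ ≤ ∑ v, g v := Finset.sum_le_sum_of_subset (Finset.subset_univ _)
    _ = _ := by
        rw [hg, Finset.sum_add_distrib, ← Finset.mul_sum, hseq, Finset.sum_boole,
          Set.ncard_eq_toFinset_card']
        simp

theorem misses_sub_le (hG : G.IsSuperFinalSingleTouch) (C : ℕ) (acc : V → List B) :
    G.misses C acc p₀ σ x - G.seqMisses C acc ≤ C * G.deviations p₀ σ x := by
  rw [tsub_le_iff_left]
  refine iSup_le fun n => ?_
  have h1 : (({v | G.IsDeviation (G.run p₀ σ x n).log v}.ncard : ℕ) : ℝ≥0∞) ≤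
      G.deviations p₀ σ x :=
    le_iSup (fun n => (({v | G.IsDeviation (G.run p₀ σ x n).log v}.ncard : ℕ) : ℝ≥0∞)) n
  refine le_trans ?_ (add_le_add_right (mul_le_mul_right h1 (C : ℝ≥0∞)) _)
  exact_mod_cast misses_le hG C acc n

end FutureDag

/-! ### The potential of a state and the effect of a steal. -/

section Potential

variable {V : Type*} {P : ℕ}

/-- The total weight of a list with geometrically growing weights is dominated by its last term. -/
theorem sum_pow_le_last {T : ℕ} {d : V → ℕ} (hd : ∀ v, d v ≤ T) {l : List V}
    (hl : l.Pairwise (fun a c => d c < d a)) :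
    (l.map (fun c => (6 : ℝ) ^ (T - d c))).sum ≤
      6 / 5 * l.getLast?.elim 0 (fun c => (6 : ℝ) ^ (T - d c)) := by
  induction l using List.reverseRecOn with
  | nil => simp
  | append_singleton l c ih =>
    rw [List.pairwise_append] at hl
    have h1 := ih hl.1
    -- The depth drops by at least one towards the top, so the previous entry weighs at most a
    -- sixth, and `6 / 5 * (1 / 6) + 1 = 6 / 5`.
    have h2 : l.getLast?.elim 0 (fun c => (6 : ℝ) ^ (T - d c)) ≤ 6 ^ (T - d c) / 6 := by
      rcases e : l.getLast? with _ | a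
      · simp only [Option.elim_none]; positivity
      · have h3 := hl.2.2 a (List.mem_of_getLast? e) c (by simp)
        simp only [Option.elim_some]
        rw [le_div_iff₀ (by norm_num), ← pow_succ]
        have := hd a
        exact pow_le_pow_right₀ (by norm_num) (by omega)
    simp only [List.map_append, List.map_cons, List.map_nil, List.sum_append, List.sum_cons,
      List.sum_nil, add_zero, List.getLast?_append, List.getLast?_singleton, Option.some_or,
      Option.elim_some]
    linarith

/-- The potential of the nodes held by a processor. -/
noncomputable def procPotential (β : ℝ) (w : V → ℝ) (t : ℝ) (cur : Option V) (dq : List V) : ℝ :=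
  cur.elim 0 (fun a => (2 - t / β) * w a) + (dq.map (fun c => 4 * w c)).sum

/-- The potential of a state: a node `v` in a deque counts `4 w v`, and a node that a processor is
going to execute counts between `w v` and `2 w v`, decreasing with the clock of the processor. -/
noncomputable def WSState.potential (s : WSState V P) (β : ℝ) (w : V → ℝ) (τ : Fin P → ℕ) : ℝ :=
  ∑ p, procPotential β w (τ p) (s.cur p) (s.dq p)

/-- The total weight of the nodes that processors are going to execute. -/
noncomputable def WSState.curWeight (s : WSState V P) (w : V → ℝ) : ℝ :=
  ∑ p, (s.cur p).elim 0 w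

/-- The weight of the top node of a deque. -/
noncomputable def topWeight (w : V → ℝ) (l : List V) : ℝ := l.getLast?.elim 0 w

theorem topWeight_nonneg {w : V → ℝ} (hw : ∀ v, 0 ≤ w v) (l : List V) : 0 ≤ topWeight w l := by
  unfold topWeight
  cases l.getLast? <;> simp [hw]

theorem elim_nonneg {w : V → ℝ} (hw : ∀ v, 0 ≤ w v) (o : Option V) : 0 ≤ o.elim 0 w := by
  cases o <;> simp [hw]

theorem WSState.curWeight_nonneg (s : WSState V P) {w : V → ℝ} (hw : ∀ v, 0 ≤ w v) :
    0 ≤ s.curWeight w := Finset.sum_nonneg fun _ _ => elim_nonneg hw _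

/-- The effect of a steal attempt on the potential. -/
theorem WSState.potential_steal {s : WSState V P} {p q : Fin P} (hp : s.cur p = none)
    (hdp : s.dq p = []) {β : ℝ} {w : V → ℝ} {τ τ' : Fin P → ℕ} (hτp : τ' p = 0)
    (hτ : ∀ o, o ≠ p → τ' o = τ o + 1) :
    (s.steal p q).potential β w τ' =
      s.potential β w τ - s.curWeight w / β - 2 * topWeight w (s.dq q) := by
  -- Every node about to be executed loses `w / β` as the clocks tick. The stolen node counts 4 with
  -- the victim and 2 with the thief, whose clock is zero. With an empty deque the top weight is 0.
  have h1 : ∀ o, procPotential β w (τ' o) ((s.steal p q).cur o) ((s.steal p q).dq o) =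
      procPotential β w (τ o) (s.cur o) (s.dq o) - (s.cur o).elim 0 w / β +
        (if o = p then 2 * topWeight w (s.dq q) else 0) +
        (if o = q then -4 * topWeight w (s.dq q) else 0) := by
    intro o
    rcases List.eq_nil_or_concat' (s.dq q) with hq | ⟨l, c, hq⟩
    · rw [FutureDag.steal_eq_self hq, hq]
      simp only [topWeight, List.getLast?_nil, Option.elim_none, mul_zero, ite_self, add_zero]
      by_cases ho : o = p
      · subst ho; simp [procPotential, hp]
      · rw [hτ o ho]
        unfold procPotential
        rcases s.cur o with _ | a
        · simp
        · simp only [Option.elim_some]; push_cast; ring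
    · rw [FutureDag.steal_eq hq]
      have htop : topWeight w (s.dq q) = w c := by simp [topWeight, hq]
      have hqp : p ≠ q := by rintro rfl; simp [hdp] at hq
      rw [htop]
      by_cases ho : o = p
      · subst ho
        simp [procPotential, hp, hdp, hqp, hτp]
      · have hcur : (2 - (τ' o : ℝ) / β) = (2 - (τ o : ℝ) / β) - 1 / β := by
          rw [hτ o ho]; push_cast; ring
        simp only [Function.update_of_ne ho, procPotential, hcur, ho, if_false]
        have hc : (s.cur o).elim 0 (fun a => (2 - (τ o : ℝ) / β - 1 / β) * w a) =
            (s.cur o).elim 0 (fun a => (2 - (τ o : ℝ) / β) * w a) - (s.cur o).elim 0 w / β := by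
          rcases s.cur o with _ | a
          · simp
          · simp only [Option.elim_some]; ring
        rw [hc]
        by_cases hoq : o = q
        · subst hoq
          simp only [Function.update_self, hq, List.map_append, List.sum_append, List.map_cons,
            List.map_nil, List.sum_cons, List.sum_nil, if_true]
          ring
        · simp only [Function.update_of_ne hoq, hoq, if_false]; ring
  unfold WSState.potential WSState.curWeight
  rw [Finset.sum_congr rfl fun o _ => h1 o]
  simp only [Finset.sum_add_distrib, Finset.sum_sub_distrib, Finset.sum_ite_eq', Finset.mem_univ,
    if_true, Finset.sum_div]
  ring

end Potential

namespace FutureDag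

variable {V : Type*} [Fintype V] {G : FutureDag V} {P : ℕ}
variable {p₀ : Fin P} {σ : Adversary P} {x : ℕ → Fin P}

/-! ### Depths -/

open scoped Classical in
variable (G) in
/-- The depth of a node in the tree in which a node is the parent of those that it enables. -/
noncomputable def depth (p₀ : Fin P) (σ : Adversary P) (x : ℕ → Fin P) : ℕ → V → ℕ
  | 0 => fun _ => 0
  | n + 1 => match (G.run p₀ σ x n).cur (σ.sched x n) with
    | none => depth p₀ σ x n
    | some a => fun c =>
        if c ∈ G.enabled ((σ.sched x n, a) :: (G.run p₀ σ x n).log) a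
        then depth p₀ σ x n a + 1 else depth p₀ σ x n c

theorem depth_succ_of_none {n : ℕ} (h : (G.run p₀ σ x n).cur (σ.sched x n) = none) :
    G.depth p₀ σ x (n + 1) = G.depth p₀ σ x n := by
  simp [depth, h]

theorem depth_succ_of_mem {n : ℕ} {a c : V}
    (h : (G.run p₀ σ x n).cur (σ.sched x n) = some a)
    (hc : c ∈ G.enabled ((σ.sched x n, a) :: (G.run p₀ σ x n).log) a) :
    G.depth p₀ σ x (n + 1) c = G.depth p₀ σ x n a + 1 := by
  simp [depth, h, hc]

theorem depth_succ_of_notMem {n : ℕ} {a c : V}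
    (h : (G.run p₀ σ x n).cur (σ.sched x n) = some a)
    (hc : c ∉ G.enabled ((σ.sched x n, a) :: (G.run p₀ σ x n).log) a) :
    G.depth p₀ σ x (n + 1) c = G.depth p₀ σ x n c := by
  simp [depth, h, hc]

theorem depth_succ_of_held {n : ℕ} {a c : V}
    (h : (G.run p₀ σ x n).cur (σ.sched x n) = some a) {q : Fin P}
    (hc : c ∈ (G.run p₀ σ x n).held q) : G.depth p₀ σ x (n + 1) c = G.depth p₀ σ x n c :=
  depth_succ_of_notMem h fun k => ((valid_run p₀ σ x n).of_mem_enabled h k).2 q hc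

/-- A path of enabling nodes is a path of the computation, so the span bounds all depths. -/
theorem exists_chain_depth (n : ℕ) (v : V) : ∃ l : List V, l.IsChain G.Edge ∧
    l.getLast? = some v ∧ l.length = G.depth p₀ σ x n v + 1 := by
  induction n generalizing v with
  | zero => exact ⟨[v], List.isChain_singleton v, rfl, rfl⟩
  | succ n ih =>
    rcases h : (G.run p₀ σ x n).cur (σ.sched x n) with _ | a
    · rw [depth_succ_of_none h]; exact ih v
    · by_cases hv : v ∈ G.enabled ((σ.sched x n, a) :: (G.run p₀ σ x n).log) a
      · rw [depth_succ_of_mem h hv]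
        obtain ⟨l, h1, h2, h3⟩ := ih a
        refine ⟨l ++ [v], List.isChain_append.2 ⟨h1, List.isChain_singleton v, ?_⟩, by simp,
          by simp [h3]⟩
        intro c hc d hd
        simp only [List.head?_cons, Option.mem_def, Option.some.injEq] at hc hd
        rw [h2] at hc
        rw [← hd, ← Option.some.inj hc]
        exact (mem_enabled.1 hv).1
      · rw [depth_succ_of_notMem h hv]; exact ih v

theorem depth_le_span (n : ℕ) (v : V) : G.depth p₀ σ x n v ≤ G.span := by
  obtain ⟨l, h1, -, h3⟩ := exists_chain_depth (G := G) (p₀ := p₀) (σ := σ) (x := x) n v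
  exact le_span h1 h3

/-- In every deque the depths decrease strictly from the bottom to the top. -/
theorem depth_sorted (hG : G.IsSuperFinalSingleTouch) (n : ℕ) (p : Fin P) :
    ((G.run p₀ σ x n).dq p).Pairwise (fun a c => G.depth p₀ σ x n c < G.depth p₀ σ x n a) ∧
      ∀ a, (G.run p₀ σ x n).cur p = some a →
        ∀ c ∈ (G.run p₀ σ x n).dq p, G.depth p₀ σ x n c ≤ G.depth p₀ σ x n a := by
  induction n generalizing p with
  | zero => simp [run, FutureDag.init]
  | succ n ih =>
    have hval := valid_run (G := G) p₀ σ x n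
    rcases h : (G.run p₀ σ x n).cur (σ.sched x n) with _ | a
    · rw [run_succ_of_none h, depth_succ_of_none h]
      set s := G.run p₀ σ x n with hs
      rcases List.eq_nil_or_concat' (s.dq (x n)) with hq | ⟨l, c, hq⟩
      · rw [steal_eq_self hq]; exact ih p
      rw [steal_eq hq]
      have hne : σ.sched x n ≠ x n := by
        intro e
        have := hval.idle _ h
        rw [e] at this
        rw [this] at hq
        simp at hq
      have hsub : Function.update s.dq (x n) l p <+: s.dq p := by
        by_cases hp : p = x n
        · subst hp
          rw [Function.update_self, hq]; exact List.prefix_append _ _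
        · rw [Function.update_of_ne hp]
      refine ⟨(ih p).1.sublist hsub.sublist, fun a ha d hd => ?_⟩
      by_cases hp : p = σ.sched x n
      · have hd' := hsub.subset hd
        rw [hp, hs, hval.idle _ h] at hd'
        simp at hd'
      · simp only [Function.update_of_ne hp] at ha
        exact (ih p).2 a ha d (hsub.subset hd)
    · rw [run_succ_of_some h]
      set s := G.run p₀ σ x n with hs
      by_cases hp : p = σ.sched x n
      swap
      · rw [execute_dq_of_ne _ _ hp, execute_cur_of_ne _ _ hp]
        refine ⟨(ih p).1.imp_of_mem fun {b c} hb hc hbc => ?_, fun b hb c hc => ?_⟩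
        · rw [depth_succ_of_held h (mem_held_of_dq hb), depth_succ_of_held h (mem_held_of_dq hc)]
          exact hbc
        · rw [depth_succ_of_held h (mem_held_of_cur hb), depth_succ_of_held h (mem_held_of_dq hc)]
          exact (ih p).2 b hb c hc
      subst hp
      rw [execute_dq_self, execute_cur_self]
      have hlen := hval.length_enabled_le hG h
      have hdq : (s.dq (σ.sched x n)).Pairwise
          (fun a c => G.depth p₀ σ x (n + 1) c < G.depth p₀ σ x (n + 1) a) :=
        (ih _).1.imp_of_mem fun {b c} hb hc hbc => by
          rw [depth_succ_of_held h (mem_held_of_dq hb), depth_succ_of_held h (mem_held_of_dq hc)]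
          exact hbc
      have hold : ∀ c ∈ s.dq (σ.sched x n), G.depth p₀ σ x (n + 1) c ≤ G.depth p₀ σ x n a :=
        fun c hc => by
          rw [depth_succ_of_held h (mem_held_of_dq hc)]
          exact (ih _).2 a h c hc
      have hnew := fun c => depth_succ_of_mem (c := c) h
      generalize G.enabled ((σ.sched x n, a) :: s.log) a = E at hlen hnew ⊢
      generalize s.dq (σ.sched x n) = D at hdq hold ⊢
      -- At most two children are enabled, both one level deeper than `a`, which is at least as deep
      -- as its deque. The pushed child is therefore strictly deeper than the old entries, and as
      -- deep as the child with which the processor continues.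
      match E, hlen with
      | [], _ =>
        rcases D with _ | ⟨b, D⟩
        · simp
        · rw [List.pairwise_cons] at hdq
          simp only [List.nil_append, List.tail_cons, List.head?_cons, Option.some.injEq]
          refine ⟨hdq.2, ?_⟩
          rintro _ rfl c hc
          exact (hdq.1 c hc).le
      | [b], _ =>
        simp only [List.cons_append, List.nil_append, List.tail_cons, List.head?_cons,
          Option.some.injEq]
        refine ⟨hdq, ?_⟩
        rintro _ rfl c hc
        have := hold c hc
        rw [hnew b (by simp)]
        omega
      | [b, d], _ =>
        simp only [List.cons_append, List.nil_append, List.tail_cons, List.head?_cons,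
          Option.some.injEq]
        refine ⟨List.pairwise_cons.2 ⟨fun c hc => ?_, hdq⟩, ?_⟩
        · have := hold c hc
          rw [hnew d (by simp)]
          omega
        · rintro _ rfl c hc
          rw [hnew b (by simp)]
          rcases List.mem_cons.1 hc with rfl | hc
          · rw [hnew c (by simp)]
          · have := hold c hc
            omega

/-! ### Clocks -/

variable (G) in
/-- The number of steal attempts of all processors since the last step of processor `q`. -/
noncomputable def clock (p₀ : Fin P) (σ : Adversary P) (x : ℕ → Fin P) : ℕ → Fin P → ℕ
  | 0 => fun _ => 0
  | n + 1 => fun q => if q = σ.sched x n then 0 else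
      clock p₀ σ x n q + if (G.run p₀ σ x n).cur (σ.sched x n) = none then 1 else 0

-- Writes the clock as a count of steal attempts over a period without a step of `q`, the form to
-- which the yield rule applies.
open scoped Classical in
theorem clock_eq_card (n : ℕ) (q : Fin P) : ∃ m ≤ n, (∀ k ∈ Finset.Ico m n, σ.sched x k ≠ q) ∧
    G.clock p₀ σ x n q = ((Finset.Ico m n).filter
      (fun k => (G.run p₀ σ x k).cur (σ.sched x k) = none)).card := by
  induction n with
  | zero => exact ⟨0, le_rfl, by simp, by simp [clock]⟩
  | succ n ih =>
    by_cases hq : q = σ.sched x n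
    · exact ⟨n + 1, le_rfl, by simp, by simp [clock, hq]⟩
    · obtain ⟨m, hm, h1, h2⟩ := ih
      have hI : Finset.Ico m (n + 1) = insert n (Finset.Ico m n) := by
        ext k; simp only [Finset.mem_Ico, Finset.mem_insert]; omega
      refine ⟨m, by omega, fun k hk => ?_, ?_⟩
      · rw [hI, Finset.mem_insert] at hk
        rcases hk with rfl | hk
        exacts [fun e => hq e.symm, h1 k hk]
      · rw [hI, Finset.filter_insert]
        simp only [clock, hq, if_false]
        split_ifs
        · rw [Finset.card_insert_of_notMem (by simp), h2]
        · rw [h2, add_zero]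

/-- While `q` does not act, each of the `P` processors can make at most `b` steal attempts. -/
theorem clock_le {b : ℕ} (hσ : G.YieldFair b p₀ σ) (n : ℕ) (q : Fin P) :
    G.clock p₀ σ x n q ≤ P * b := by
  classical
  obtain ⟨m, -, h1, h2⟩ := clock_eq_card (G := G) (p₀ := p₀) (σ := σ) (x := x) n q
  rw [h2]
  calc _ ≤ (Finset.univ.biUnion fun p =>
        (Finset.Ico m n).filter (G.StealAttempt p₀ σ x p)).card := by
        refine Finset.card_le_card fun k hk => ?_
        rw [Finset.mem_filter] at hk
        refine Finset.mem_biUnion.2 ⟨σ.sched x k, Finset.mem_univ _, Finset.mem_filter.2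
          ⟨hk.1, rfl, hk.2⟩⟩
    _ ≤ ∑ p : Fin P, b := by
        refine Finset.card_biUnion_le.trans (Finset.sum_le_sum fun p _ => ?_)
        by_contra! hlt
        obtain ⟨k, hk, hk'⟩ := hσ x m n p (by convert hlt) q
        exact h1 k hk hk'
    _ = _ := by simp

/-! ### The potential -/

variable (G) in
/-- The weight of a node, depending on its depth. -/
noncomputable def weight (p₀ : Fin P) (σ : Adversary P) (x : ℕ → Fin P) (n : ℕ) (v : V) : ℝ :=
  6 ^ (G.span - G.depth p₀ σ x n v)

theorem weight_pos (n : ℕ) (v : V) : 0 < G.weight p₀ σ x n v := by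
  unfold weight; positivity

theorem one_le_weight (n : ℕ) (v : V) : 1 ≤ G.weight p₀ σ x n v :=
  one_le_pow₀ (by norm_num)

variable (G) in
/-- The potential after `n` steps, for yield parameter `b`. -/
noncomputable def potential (b : ℕ) (p₀ : Fin P) (σ : Adversary P) (x : ℕ → Fin P) (n : ℕ) : ℝ :=
  (G.run p₀ σ x n).potential ((b + 1) * P) (G.weight p₀ σ x n) (G.clock p₀ σ x n)

theorem weight_enabled {n : ℕ} {a c : V} (h : (G.run p₀ σ x n).cur (σ.sched x n) = some a)
    (hc : c ∈ G.enabled ((σ.sched x n, a) :: (G.run p₀ σ x n).log) a) :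
    6 * G.weight p₀ σ x (n + 1) c = G.weight p₀ σ x n a := by
  -- The child has depth at most the span, so the parent lies strictly above that bound and the
  -- truncated subtraction in the exponent is exact.
  have h1 := depth_le_span (G := G) (p₀ := p₀) (σ := σ) (x := x) (n + 1) c
  unfold weight
  rw [depth_succ_of_mem h hc] at h1 ⊢
  rw [← pow_succ']
  congr 1
  omega

theorem weight_succ_of_held {n : ℕ} {a c : V}
    (h : (G.run p₀ σ x n).cur (σ.sched x n) = some a) {q : Fin P}
    (hc : c ∈ (G.run p₀ σ x n).held q) : G.weight p₀ σ x (n + 1) c = G.weight p₀ σ x n c := by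
  unfold weight
  rw [depth_succ_of_held h hc]

/-- Keeps the factor of a node about to be executed between 1 and 2. Dividing by `(b + 1) * P`
instead of `b * P` covers `b = 0`. -/
theorem clock_div_le_one {b : ℕ} (hσ : G.YieldFair b p₀ σ) (n : ℕ) (q : Fin P) :
    (G.clock p₀ σ x n q : ℝ) / ((b + 1) * P) ≤ 1 := by
  have hP : (0 : ℝ) < P := by exact_mod_cast p₀.pos
  rw [div_le_one (by positivity)]
  have h := clock_le (x := x) hσ n q
  have h' : (G.clock p₀ σ x n q : ℝ) ≤ P * b := by exact_mod_cast h
  nlinarith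

theorem clock_div_nonneg (b n : ℕ) (q : Fin P) :
    0 ≤ (G.clock p₀ σ x n q : ℝ) / ((b + 1) * P) := by positivity

/-- Executing a node does not increase the potential. -/
theorem potential_execute_le (hG : G.IsSuperFinalSingleTouch) {b : ℕ} (hσ : G.YieldFair b p₀ σ)
    {n : ℕ} {a : V} (h : (G.run p₀ σ x n).cur (σ.sched x n) = some a) :
    G.potential b p₀ σ x (n + 1) ≤ G.potential b p₀ σ x n := by
  have hval := valid_run (G := G) p₀ σ x n
  unfold potential WSState.potential
  refine Finset.sum_le_sum fun q _ => ?_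
  rw [run_succ_of_some h]
  have hdqsum : ∀ q, (((G.run p₀ σ x n).dq q).map fun c => 4 * G.weight p₀ σ x (n + 1) c).sum =
      (((G.run p₀ σ x n).dq q).map fun c => 4 * G.weight p₀ σ x n c).sum := by
    intro q
    congr 1
    refine List.map_congr_left fun c hc => ?_
    rw [weight_succ_of_held h (mem_held_of_dq hc)]
  by_cases hq : q = σ.sched x n
  · subst hq
    have hclock : G.clock p₀ σ x (n + 1) (σ.sched x n) = 0 := by simp [clock]
    have hτ := clock_div_le_one (x := x) hσ n (σ.sched x n)
    rw [execute_cur_self, execute_dq_self, hclock, h]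
    unfold procPotential
    rw [← hdqsum]
    have hlen := hval.length_enabled_le hG h
    have hen := fun c => weight_enabled (c := c) h
    have hpos := fun c => weight_pos (G := G) (p₀ := p₀) (σ := σ) (x := x) (n + 1) c
    have ha := weight_pos (G := G) (p₀ := p₀) (σ := σ) (x := x) n a
    have ha' : G.weight p₀ σ x n a ≤
        (2 - (G.clock p₀ σ x n (σ.sched x n) : ℝ) / ((b + 1) * P)) * G.weight p₀ σ x n a := by
      nlinarith
    simp only [Option.elim_some, Nat.cast_zero, zero_div, sub_zero]
    generalize G.enabled ((σ.sched x n, a) :: (G.run p₀ σ x n).log) a = E at hlen hen ⊢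
    generalize (G.run p₀ σ x n).dq (σ.sched x n) = D
    -- A node about to be executed counts at least once its weight. Two enabled children count `2 +
    -- 4 = 6` times a sixth of that weight, which explains the base 6. A node popped instead falls
    -- from 4 to 2.
    match E, hlen with
    | [], _ =>
      rcases D with _ | ⟨c, D⟩
      · simp only [List.append_nil, List.head?_nil, List.tail_nil, List.map_nil, List.sum_nil,
          Option.elim_none]
        linarith
      · have := hpos c
        simp only [List.nil_append, List.head?_cons, Option.elim_some, List.tail_cons,
          List.map_cons, List.sum_cons]
        linarith
    | [c], _ =>
      have h1 := hen c (by simp)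
      have h2 := hpos c
      simp only [List.cons_append, List.nil_append, List.head?_cons, Option.elim_some,
        List.tail_cons]
      linarith
    | [c, d], _ =>
      have h1 := hen c (by simp)
      have h2 := hen d (by simp)
      simp only [List.cons_append, List.nil_append, List.head?_cons, Option.elim_some,
        List.tail_cons, List.map_cons, List.sum_cons]
      linarith
  · have hclock : G.clock p₀ σ x (n + 1) q = G.clock p₀ σ x n q := by simp [clock, hq, h]
    rw [execute_cur_of_ne _ _ hq, execute_dq_of_ne _ _ hq, hclock]
    unfold procPotential
    rw [hdqsum]
    refine le_of_eq (congrArg (· + _) ?_)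
    rcases hc : (G.run p₀ σ x n).cur q with _ | c
    · rfl
    · simp only [Option.elim_some]
      rw [weight_succ_of_held h (mem_held_of_cur hc)]

theorem potential_steal_eq {b n : ℕ} (h : (G.run p₀ σ x n).cur (σ.sched x n) = none) :
    G.potential b p₀ σ x (n + 1) = G.potential b p₀ σ x n -
      (G.run p₀ σ x n).curWeight (G.weight p₀ σ x n) / ((b + 1) * P) -
      2 * topWeight (G.weight p₀ σ x n) ((G.run p₀ σ x n).dq (x n)) := by
  have hw : G.weight p₀ σ x (n + 1) = G.weight p₀ σ x n := by
    unfold weight; rw [depth_succ_of_none h]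
  unfold potential
  rw [run_succ_of_none h, hw]
  refine WSState.potential_steal h ((valid_run p₀ σ x n).idle _ h) ?_ ?_
  · simp [clock]
  · intro o ho
    simp [clock, ho, h]

theorem potential_steal_le {b n : ℕ} (h : (G.run p₀ σ x n).cur (σ.sched x n) = none) :
    G.potential b p₀ σ x (n + 1) ≤ G.potential b p₀ σ x n := by
  have hw : ∀ v, 0 ≤ G.weight p₀ σ x n v := fun v => (weight_pos n v).le
  rw [potential_steal_eq h]
  have h1 := (G.run p₀ σ x n).curWeight_nonneg hw
  have h2 := topWeight_nonneg hw ((G.run p₀ σ x n).dq (x n))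
  have h3 : 0 ≤ (G.run p₀ σ x n).curWeight (G.weight p₀ σ x n) / (((b : ℝ) + 1) * P) := by
    positivity
  linarith

/-- A deque is dominated by its top node, the only one that a steal can reach: `24 / 5` is 4 times
the `6 / 5` of `sum_pow_le_last`. -/
theorem potential_le (hG : G.IsSuperFinalSingleTouch) (b n : ℕ) :
    G.potential b p₀ σ x n ≤ 2 * (G.run p₀ σ x n).curWeight (G.weight p₀ σ x n) +
      24 / 5 * ∑ q, topWeight (G.weight p₀ σ x n) ((G.run p₀ σ x n).dq q) := by
  unfold potential WSState.potential WSState.curWeight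
  rw [Finset.mul_sum, Finset.mul_sum, ← Finset.sum_add_distrib]
  refine Finset.sum_le_sum fun q _ => add_le_add ?_ ?_
  · rcases (G.run p₀ σ x n).cur q with _ | a
    · simp
    · have h1 := clock_div_nonneg (G := G) (p₀ := p₀) (σ := σ) (x := x) b n q
      have h2 := weight_pos (G := G) (p₀ := p₀) (σ := σ) (x := x) n a
      simp only [Option.elim_some]
      nlinarith
  · have h1 := sum_pow_le_last (fun v => depth_le_span (G := G) (p₀ := p₀) (σ := σ) (x := x) n v)
      (depth_sorted (x := x) (σ := σ) (p₀ := p₀) hG n q).1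
    have h2 : (((G.run p₀ σ x n).dq q).map fun c => 4 * G.weight p₀ σ x n c).sum =
        4 * (((G.run p₀ σ x n).dq q).map (G.weight p₀ σ x n)).sum := by
      rw [List.sum_map_mul_left]
    rw [h2]
    change (List.map (G.weight p₀ σ x n) ((G.run p₀ σ x n).dq q)).sum ≤
      6 / 5 * topWeight (G.weight p₀ σ x n) ((G.run p₀ σ x n).dq q) at h1
    linarith

/-- As long as some processor holds a node, the potential is at least one. -/
theorem one_le_potential {b : ℕ} (hσ : G.YieldFair b p₀ σ) {n : ℕ} {p : Fin P} {a : V}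
    (h : (G.run p₀ σ x n).cur p = some a) : 1 ≤ G.potential b p₀ σ x n := by
  have hnn : ∀ q, 0 ≤ procPotential ((b + 1) * P) (G.weight p₀ σ x n) (G.clock p₀ σ x n q)
      ((G.run p₀ σ x n).cur q) ((G.run p₀ σ x n).dq q) := by
    intro q
    have h1 := clock_div_le_one (x := x) hσ n q
    refine add_nonneg ?_ (List.sum_nonneg ?_)
    · rcases (G.run p₀ σ x n).cur q with _ | a
      · simp
      · exact mul_nonneg (by linarith) (weight_pos n a).le
    · intro y hy
      obtain ⟨c, -, rfl⟩ := List.mem_map.1 hy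
      have := weight_pos (G := G) (p₀ := p₀) (σ := σ) (x := x) n c
      positivity
  refine le_trans ?_ (Finset.single_le_sum (fun q _ => hnn q) (Finset.mem_univ p))
  have h1 := clock_div_le_one (x := x) hσ n p
  have h2 := one_le_weight (G := G) (p₀ := p₀) (σ := σ) (x := x) n a
  have h3 : 0 ≤ (((G.run p₀ σ x n).dq p).map fun c => 4 * G.weight p₀ σ x n c).sum := by
    refine List.sum_nonneg ?_
    intro y hy
    obtain ⟨c, -, rfl⟩ := List.mem_map.1 hy
    have := weight_pos (G := G) (p₀ := p₀) (σ := σ) (x := x) n c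
    positivity
  unfold procPotential
  rw [h, Option.elim_some]
  nlinarith

theorem potential_zero (b : ℕ) : G.potential b p₀ σ x 0 = 2 * 6 ^ G.span := by
  have : ∀ p, procPotential ((b + 1) * P) (G.weight p₀ σ x 0) (G.clock p₀ σ x 0 p)
      ((G.run p₀ σ x 0).cur p) ((G.run p₀ σ x 0).dq p) =
      if p = p₀ then 2 * 6 ^ G.span else 0 := by
    intro p
    by_cases hp : p = p₀ <;> simp [procPotential, run, FutureDag.init, hp, clock, weight, depth]
  unfold potential WSState.potential
  rw [Finset.sum_congr rfl fun p _ => this p]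
  simp

end FutureDag

/-! ### Expectation and drift for independent uniform victims. -/

section Drift

open MeasureTheory ProbabilityTheory

variable {P : ℕ} {Ω : Type*} {X : ℕ → Ω → Fin P}

/-- The function `F` depends only on the first `n` terms of a sequence. -/
def DependsOnInitial {α : Type*} (n : ℕ) (F : (ℕ → Fin P) → α) : Prop :=
  ∀ x y, (∀ i < n, x i = y i) → F x = F y

theorem DependsOnInitial.exists_eq {n : ℕ} {F : (ℕ → Fin P) → ℝ≥0∞} (p₀ : Fin P)
    (hF : DependsOnInitial n F) : ∃ F' : (Finset.range n → Fin P) → ℝ≥0∞,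
      ∀ ω, F (fun k => X k ω) = F' (fun i => X i ω) := by
  refine ⟨fun h => F fun k => if hk : k ∈ Finset.range n then h ⟨k, hk⟩ else p₀, fun ω => ?_⟩
  refine hF _ _ fun i hi => ?_
  simp [hi]

variable [MeasurableSpace Ω] {μ : Measure Ω}

theorem DependsOnInitial.measurable {n : ℕ} {F : (ℕ → Fin P) → ℝ≥0∞} (p₀ : Fin P)
    (hF : DependsOnInitial n F) (hX : ∀ n, Measurable (X n)) :
    Measurable fun ω => F fun k => X k ω := by
  obtain ⟨F', hF'⟩ := hF.exists_eq (X := X) p₀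
  simp_rw [hF']
  have h1 : Measurable F' := .of_discrete
  exact h1.comp (measurable_pi_lambda _ fun i => hX i)

/-- The expectation of a function of the first `n + 1` terms of a sequence of independent uniformly
distributed random variables is obtained by averaging over the last term. -/
theorem lintegral_average_last (p₀ : Fin P) (hX : ∀ n, Measurable (X n)) (hind : iIndepFun X μ)
    (hunif : ∀ n q, μ (X n ⁻¹' {q}) = (P : ℝ≥0∞)⁻¹) {n : ℕ} {F : (ℕ → Fin P) → ℝ≥0∞}
    (hF : DependsOnInitial (n + 1) F) : ∫⁻ ω, F (fun k => X k ω) ∂μ =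
      ∫⁻ ω, (P : ℝ≥0∞)⁻¹ * ∑ q, F (Function.update (fun k => X k ω) n q) ∂μ := by
  classical
  have hFq : ∀ q, DependsOnInitial n fun x => F (Function.update x n q) := by
    intro q x y h
    refine hF _ _ fun i hi => ?_
    by_cases hin : i = n
    · subst hin; simp
    · simp [hin, h i (by omega)]
  -- Fixing the value of the last term makes `F` a function of the first `n` terms, independent of
  -- the indicator of that value.
  have hsplit : ∀ ω, F (fun k => X k ω) =
      ∑ q, (X n ⁻¹' {q}).indicator 1 ω * F (Function.update (fun k => X k ω) n q) := by
    intro ω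
    rw [Finset.sum_eq_single (X n ω)]
    · rw [Set.indicator_of_mem (by simp), Pi.one_apply, one_mul]
      congr 1
      exact (Function.update_eq_self n _).symm
    · intro q _ hq
      rw [Set.indicator_of_notMem (by simpa using hq.symm), zero_mul]
    · simp
  have hmeas := fun q => (hFq q).measurable p₀ hX
  have hset : ∀ q, MeasurableSet (X n ⁻¹' {q}) := fun q => hX n (measurableSet_singleton q)
  have hprod : ∀ q, ∫⁻ ω, (X n ⁻¹' {q}).indicator 1 ω *
      F (Function.update (fun k => X k ω) n q) ∂μ =
        (P : ℝ≥0∞)⁻¹ * ∫⁻ ω, F (Function.update (fun k => X k ω) n q) ∂μ := by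
    intro q
    obtain ⟨F', hF'⟩ := (hFq q).exists_eq (X := X) p₀
    have hI := hind.indepFun_finset {n} (Finset.range n) (by simp) hX
    have h1 : Measurable fun h : (({n} : Finset ℕ) → Fin P) =>
        ({q} : Set (Fin P)).indicator (1 : Fin P → ℝ≥0∞) (h ⟨n, by simp⟩) := .of_discrete
    have h2 : Measurable F' := .of_discrete
    have hI' := hI.comp h1 h2
    have hm1 : Measurable fun ω => (X n ⁻¹' {q}).indicator (1 : Ω → ℝ≥0∞) ω :=
      measurable_one.indicator (hset q)
    have key := lintegral_mul_eq_lintegral_mul_lintegral_of_indepFun hm1 (hmeas q)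
      (by
        have e : (fun ω => F (Function.update (fun k => X k ω) n q)) =
            F' ∘ fun a (i : Finset.range n) => X i a := funext hF'
        rw [e]
        exact hI')
    have hone : ∫⁻ ω, (X n ⁻¹' {q}).indicator (1 : Ω → ℝ≥0∞) ω ∂μ = (P : ℝ≥0∞)⁻¹ := by
      rw [lintegral_indicator_one (hset q), hunif]
    rw [← hone]
    exact key
  simp_rw [hsplit]
  have hterm : ∀ q, Measurable fun ω => (X n ⁻¹' {q}).indicator (1 : Ω → ℝ≥0∞) ω *
      F (Function.update (fun k => X k ω) n q) :=
    fun q => (measurable_one.indicator (hset q)).mul (hmeas q)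
  rw [lintegral_finsetSum _ fun q _ => hterm q,
    Finset.sum_congr rfl fun q _ => hprod q, ← Finset.mul_sum,
    ← lintegral_finsetSum _ fun q _ => hmeas q, ← lintegral_const_mul _
      (Finset.measurable_fun_sum _ fun q _ => hmeas q)]

/-- If a nonnegative quantity decreases by `a n` on average in step `n`, then the expectation of the
sum of all `a n` is at most its initial value. -/
theorem lintegral_tsum_le_of_drift [IsProbabilityMeasure μ] (p₀ : Fin P)
    (hX : ∀ n, Measurable (X n)) (hind : iIndepFun X μ)
    (hunif : ∀ n q, μ (X n ⁻¹' {q}) = (P : ℝ≥0∞)⁻¹) {Y a : ℕ → (ℕ → Fin P) → ℝ≥0∞}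
    (hY : ∀ n, DependsOnInitial n (Y n)) (ha : ∀ n, DependsOnInitial n (a n))
    (hdrift : ∀ n x, (P : ℝ≥0∞)⁻¹ * ∑ q, Y (n + 1) (Function.update x n q) + a n x ≤ Y n x)
    {y₀ : ℝ≥0∞} (hy₀ : ∀ x, Y 0 x ≤ y₀) : ∫⁻ ω, ∑' n, a n (fun k => X k ω) ∂μ ≤ y₀ := by
  have hstep : ∀ n, ∫⁻ ω, Y (n + 1) (fun k => X k ω) ∂μ + ∫⁻ ω, a n (fun k => X k ω) ∂μ ≤
      ∫⁻ ω, Y n (fun k => X k ω) ∂μ := by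
    intro n
    rw [lintegral_average_last p₀ hX hind hunif (hY (n + 1)),
      ← lintegral_add_right _ ((ha n).measurable p₀ hX)]
    exact lintegral_mono fun ω => hdrift n _
  have hsum : ∀ n, ∫⁻ ω, Y n (fun k => X k ω) ∂μ +
      ∑ k ∈ Finset.range n, ∫⁻ ω, a k (fun k => X k ω) ∂μ ≤ y₀ := by
    intro n
    induction n with
    | zero =>
      rw [Finset.sum_range_zero, add_zero]
      calc _ ≤ ∫⁻ _, y₀ ∂μ := lintegral_mono fun ω => hy₀ _
        _ = y₀ := by simp
    | succ n ih =>
      rw [Finset.sum_range_succ]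
      calc _ = (∫⁻ ω, Y (n + 1) (fun k => X k ω) ∂μ + ∫⁻ ω, a n (fun k => X k ω) ∂μ) +
            ∑ k ∈ Finset.range n, ∫⁻ ω, a k (fun k => X k ω) ∂μ := by ring
        _ ≤ _ := (add_le_add_left (hstep n) _).trans ih
  rw [lintegral_tsum fun n => ((ha n).measurable p₀ hX).aemeasurable]
  exact ENNReal.tsum_le_of_sum_range_le fun n => le_add_self.trans (hsum n)

end Drift

namespace FutureDag

variable {V : Type*} [Fintype V] {G : FutureDag V} {P : ℕ}
variable {p₀ : Fin P} {σ : Adversary P}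

/-! ### Dependence on the victims -/

theorem sched_congr {n : ℕ} {x y : ℕ → Fin P} (h : ∀ i < n, x i = y i) :
    σ.sched x n = σ.sched y n :=
  congrArg (σ n) (funext fun i => h i i.2)

theorem run_congr {n : ℕ} {x y : ℕ → Fin P} (h : ∀ i < n, x i = y i) :
    G.run p₀ σ x n = G.run p₀ σ y n := by
  induction n with
  | zero => rfl
  | succ n ih =>
    have h' : ∀ i < n, x i = y i := fun i hi => h i (by omega)
    simp only [run, ih h', sched_congr h', h n (by omega)]

theorem depth_congr {n : ℕ} {x y : ℕ → Fin P} (h : ∀ i < n, x i = y i) :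
    G.depth p₀ σ x n = G.depth p₀ σ y n := by
  induction n with
  | zero => rfl
  | succ n ih =>
    have h' : ∀ i < n, x i = y i := fun i hi => h i (by omega)
    simp only [depth]
    rw [ih h', sched_congr h', run_congr h']

theorem clock_congr {n : ℕ} {x y : ℕ → Fin P} (h : ∀ i < n, x i = y i) :
    G.clock p₀ σ x n = G.clock p₀ σ y n := by
  induction n with
  | zero => rfl
  | succ n ih =>
    have h' : ∀ i < n, x i = y i := fun i hi => h i (by omega)
    simp only [clock, ih h', sched_congr h', run_congr h']

theorem potential_congr {b n : ℕ} {x y : ℕ → Fin P} (h : ∀ i < n, x i = y i) :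
    G.potential b p₀ σ x n = G.potential b p₀ σ y n := by
  unfold potential weight
  rw [run_congr h, depth_congr h, clock_congr h]

/-! ### The number of steal attempts -/

variable (G) in
/-- Step `n` is a steal attempt, and some processor is going to execute a node. -/
def LiveAttempt (p₀ : Fin P) (σ : Adversary P) (n : ℕ) (x : ℕ → Fin P) : Prop :=
  (G.run p₀ σ x n).cur (σ.sched x n) = none ∧ ∃ p a, (G.run p₀ σ x n).cur p = some a

open scoped Classical in
variable (G) in
/-- The indicator of `LiveAttempt`. -/
noncomputable def liveAttempt (p₀ : Fin P) (σ : Adversary P) (n : ℕ) (x : ℕ → Fin P) : ℝ≥0∞ :=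
  if G.LiveAttempt p₀ σ n x then 1 else 0

theorem dependsOnInitial_liveAttempt (n : ℕ) : DependsOnInitial n (G.liveAttempt p₀ σ n) := by
  intro x y h
  unfold liveAttempt LiveAttempt
  rw [run_congr h, sched_congr h]

/-- A victim with a nonempty deque also holds a node to execute, so every successful steal is a live
attempt. -/
theorem length_stolen_le (x : ℕ → Fin P) (n : ℕ) : ((G.stolen p₀ σ x n).length : ℝ≥0∞) ≤
    ∑ k ∈ Finset.range n, G.liveAttempt p₀ σ k x := by
  induction n with
  | zero => simp [stolen]
  | succ n ih =>
    rw [Finset.sum_range_succ]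
    rcases h : (G.run p₀ σ x n).cur (σ.sched x n) with _ | a
    · rw [stolen_succ_of_none h, List.length_append, add_comm, Nat.cast_add]
      refine add_le_add ih ?_
      rcases hd : ((G.run p₀ σ x n).dq (x n)).getLast? with _ | c
      · simp
      · have hlive : G.LiveAttempt p₀ σ n x := by
          refine ⟨h, x n, ?_⟩
          by_contra! hcon
          have := (valid_run p₀ σ x n).idle (x n) (Option.eq_none_iff_forall_ne_some.2 hcon)
          simp [this] at hd
        simp [liveAttempt, hlive]
    · rw [stolen_succ_of_some h]
      exact ih.trans le_self_add

variable (G) in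
/-- The logarithm of the potential (zero after the execution has ended). -/
noncomputable def logPotential (b : ℕ) (p₀ : Fin P) (σ : Adversary P) (n : ℕ) (x : ℕ → Fin P) : ℝ :=
  Real.log (max 1 (G.potential b p₀ σ x n))

theorem logPotential_nonneg (b n : ℕ) (x : ℕ → Fin P) : 0 ≤ G.logPotential b p₀ σ n x :=
  Real.log_nonneg (le_max_left _ _)

theorem potential_succ_le (hG : G.IsSuperFinalSingleTouch) {b : ℕ} (hσ : G.YieldFair b p₀ σ)
    (n : ℕ) (x : ℕ → Fin P) : G.potential b p₀ σ x (n + 1) ≤ G.potential b p₀ σ x n := by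
  rcases h : (G.run p₀ σ x n).cur (σ.sched x n) with _ | a
  · exact potential_steal_le h
  · exact potential_execute_le hG hσ h

theorem logPotential_succ_le (hG : G.IsSuperFinalSingleTouch) {b : ℕ} (hσ : G.YieldFair b p₀ σ)
    (n : ℕ) (x : ℕ → Fin P) : G.logPotential b p₀ σ (n + 1) x ≤ G.logPotential b p₀ σ n x :=
  Real.log_le_log (by positivity) (max_le_max le_rfl (potential_succ_le hG hσ n x))

theorem update_agrees (x : ℕ → Fin P) (n : ℕ) (q : Fin P) :
    ∀ i < n, Function.update x n q i = x i := fun i hi => by simp [hi.ne]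

/-- A steal attempt with a random victim decreases the potential by a constant factor on average. -/
theorem sum_potential_le (hG : G.IsSuperFinalSingleTouch) (b : ℕ) {n : ℕ} {x : ℕ → Fin P}
    (h : (G.run p₀ σ x n).cur (σ.sched x n) = none) :
    ∑ q, G.potential b p₀ σ (Function.update x n q) (n + 1) ≤
      (P - 1 / (3 * (b + 1))) * G.potential b p₀ σ x n := by
  have hP : (0 : ℝ) < P := by exact_mod_cast p₀.pos
  have hq : ∀ q, G.potential b p₀ σ (Function.update x n q) (n + 1) = G.potential b p₀ σ x n -
      (G.run p₀ σ x n).curWeight (G.weight p₀ σ x n) / ((b + 1) * P) -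
      2 * topWeight (G.weight p₀ σ x n) ((G.run p₀ σ x n).dq q) := by
    intro q
    have hag := update_agrees x n q
    have hw : G.weight p₀ σ (Function.update x n q) n = G.weight p₀ σ x n := by
      unfold weight; rw [depth_congr hag]
    rw [potential_steal_eq (by rwa [run_congr hag, sched_congr hag]), potential_congr hag,
      run_congr hag, hw, Function.update_self]
  rw [Finset.sum_congr rfl fun q _ => hq q]
  have hw : ∀ v, 0 ≤ G.weight p₀ σ x n v := fun v => (weight_pos n v).le
  have h1 := (G.run p₀ σ x n).curWeight_nonneg hw
  have h2 : 0 ≤ ∑ q, topWeight (G.weight p₀ σ x n) ((G.run p₀ σ x n).dq q) :=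
    Finset.sum_nonneg fun q _ => topWeight_nonneg hw _
  have h3 := potential_le (x := x) (σ := σ) (p₀ := p₀) hG b n
  simp only [Finset.sum_sub_distrib, Finset.sum_const, Finset.card_univ, Fintype.card_fin,
    nsmul_eq_mul, ← Finset.mul_sum]
  set A := (G.run p₀ σ x n).curWeight (G.weight p₀ σ x n)
  set Q := ∑ q, topWeight (G.weight p₀ σ x n) ((G.run p₀ σ x n).dq q)
  set Φ := G.potential b p₀ σ x n
  have hb : (0 : ℝ) < b + 1 := by positivity
  have e1 : (P : ℝ) * (A / ((b + 1) * P)) = A / (b + 1) := by field_simp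
  -- Averaging over the victims gains `A / (b + 1)` from the clocks and `2 * Q` from the top nodes,
  -- in total over all `q`. Dividing `2 * A + 24 / 5 * Q` by `3 * (b + 1)` leaves coefficients `2 /
  -- 3` and at most `8 / 5`, below 1 and 2.
  have e2 : 1 / (3 * ((b : ℝ) + 1)) * Φ ≤ A / (b + 1) + 2 * Q := by
    have h4 : 1 / (3 * ((b : ℝ) + 1)) * Φ ≤ 1 / (3 * ((b : ℝ) + 1)) * (2 * A + 24 / 5 * Q) :=
      mul_le_mul_of_nonneg_left h3 (by positivity)
    have h5 : 1 / (3 * ((b : ℝ) + 1)) * (2 * A + 24 / 5 * Q) =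
        2 / 3 * (A / (b + 1)) + 8 / 5 * (Q / (b + 1)) := by
      field_simp; ring
    have h6 : Q / (b + 1) ≤ Q := div_le_self h2 (by linarith [(Nat.cast_nonneg b : (0 : ℝ) ≤ b)])
    have h7 : 0 ≤ A / ((b : ℝ) + 1) := by positivity
    linarith
  rw [e1]
  linarith

/-- Apply `log t ≤ t - 1` to the quotient of the potentials. A steal attempt executes nothing, so
the processor `p` still holds its node afterwards; both potentials are at least 1 and the truncation
in `logPotential` has no effect. -/
theorem sum_logPotential_le (hG : G.IsSuperFinalSingleTouch) {b : ℕ} (hσ : G.YieldFair b p₀ σ)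
    {n : ℕ} {x : ℕ → Fin P} (h : G.LiveAttempt p₀ σ n x) :
    ∑ q, G.logPotential b p₀ σ (n + 1) (Function.update x n q) ≤
      P * G.logPotential b p₀ σ n x - 1 / (3 * (b + 1)) := by
  obtain ⟨hcur, p, a, ha⟩ := h
  have h1 : 1 ≤ G.potential b p₀ σ x n := one_le_potential hσ ha
  have h0 : 0 < G.potential b p₀ σ x n := by linarith
  have hq : ∀ q, G.logPotential b p₀ σ (n + 1) (Function.update x n q) ≤
      G.logPotential b p₀ σ n x +
        (G.potential b p₀ σ (Function.update x n q) (n + 1) / G.potential b p₀ σ x n - 1) := by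
    intro q
    have hag := update_agrees x n q
    have hnone : (G.run p₀ σ (Function.update x n q) n).cur
        (σ.sched (Function.update x n q) n) = none := by rwa [run_congr hag, sched_congr hag]
    have hp : p ≠ σ.sched x n := by rintro rfl; simp [hcur] at ha
    have hlive : (G.run p₀ σ (Function.update x n q) (n + 1)).cur p = some a := by
      rw [run_succ_of_none hnone, run_congr hag, sched_congr hag]
      rcases List.eq_nil_or_concat' ((G.run p₀ σ x n).dq (Function.update x n q n)) with
        e | ⟨l, c, e⟩
      · rwa [steal_eq_self e]
      · rw [steal_eq e]
        simpa [hp] using ha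
    have h2 : 1 ≤ G.potential b p₀ σ (Function.update x n q) (n + 1) := one_le_potential hσ hlive
    unfold logPotential
    rw [max_eq_right h1, max_eq_right h2]
    have h3 := Real.log_le_sub_one_of_pos (div_pos (by linarith : 0 <
      G.potential b p₀ σ (Function.update x n q) (n + 1)) h0)
    rw [Real.log_div (by linarith) (by linarith)] at h3
    linarith
  refine (Finset.sum_le_sum fun q _ => hq q).trans ?_
  have h4 := sum_potential_le (σ := σ) (p₀ := p₀) hG b hcur
  rw [Finset.sum_add_distrib, Finset.sum_sub_distrib, ← Finset.sum_div]
  have h5 : (∑ q, G.potential b p₀ σ (Function.update x n q) (n + 1)) / G.potential b p₀ σ x n ≤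
      P - 1 / (3 * (b + 1)) := by
    rwa [div_le_iff₀ h0]
  simp only [Finset.sum_const, Finset.card_univ, Fintype.card_fin, nsmul_eq_mul, mul_one]
  linarith

theorem logPotential_drift (hG : G.IsSuperFinalSingleTouch) {b : ℕ} (hσ : G.YieldFair b p₀ σ)
    (n : ℕ) (x : ℕ → Fin P) :
    (P : ℝ≥0∞)⁻¹ * ∑ q, ENNReal.ofReal (G.logPotential b p₀ σ (n + 1) (Function.update x n q)) +
      (3 * (b + 1) * P : ℝ≥0∞)⁻¹ * G.liveAttempt p₀ σ n x ≤
        ENNReal.ofReal (G.logPotential b p₀ σ n x) := by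
  have hP : (0 : ℝ) < P := by exact_mod_cast p₀.pos
  have hnn := fun n x => logPotential_nonneg (G := G) (p₀ := p₀) (σ := σ) b n x
  have key : ∀ ε : ℝ, 0 ≤ ε → ∑ q, G.logPotential b p₀ σ (n + 1) (Function.update x n q) ≤
      P * G.logPotential b p₀ σ n x - ε →
      (P : ℝ≥0∞)⁻¹ * ∑ q, ENNReal.ofReal (G.logPotential b p₀ σ (n + 1) (Function.update x n q)) +
        ENNReal.ofReal (ε / P) ≤ ENNReal.ofReal (G.logPotential b p₀ σ n x) := by
    intro ε hε h
    rw [← ENNReal.ofReal_sum_of_nonneg fun q _ => hnn _ _, ← ENNReal.ofReal_natCast,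
      ← ENNReal.ofReal_inv_of_pos hP, ← ENNReal.ofReal_mul (by positivity),
      ← ENNReal.ofReal_add (mul_nonneg (by positivity) (Finset.sum_nonneg fun q _ => hnn _ _))
        (by positivity)]
    refine ENNReal.ofReal_le_ofReal ?_
    rw [inv_mul_eq_div, ← add_div, div_le_iff₀ hP]
    linarith
  by_cases hlive : G.LiveAttempt p₀ σ n x
  · refine le_trans (add_le_add le_rfl (le_of_eq ?_))
      (key (1 / (3 * (b + 1))) (by positivity) (sum_logPotential_le hG hσ hlive))
    have e : (1 / (3 * ((b : ℝ) + 1)) / P) = (3 * ((b : ℝ) + 1) * P)⁻¹ := by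
      rw [div_div, one_div]
    rw [liveAttempt, if_pos hlive, mul_one, e, ENNReal.ofReal_inv_of_pos (by positivity),
      ENNReal.ofReal_mul (by positivity), ENNReal.ofReal_mul (by positivity),
      ENNReal.ofReal_add (by positivity) (by positivity)]
    simp
  -- In all other steps no gain is claimed, and it is enough that the potential never increases.
  · have h := key 0 le_rfl (by
      rw [sub_zero]
      refine (Finset.sum_le_sum fun q _ => (logPotential_succ_le hG hσ n _)).trans ?_
      have : ∀ q, G.logPotential b p₀ σ n (Function.update x n q) = G.logPotential b p₀ σ n x :=
        fun q => by unfold logPotential; rw [potential_congr (update_agrees x n q)]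
      simp [this])
    simpa [liveAttempt, hlive] using h

theorem logPotential_zero_le (b : ℕ) (x : ℕ → Fin P) :
    G.logPotential b p₀ σ 0 x ≤ 1 + 5 * G.span := by
  unfold logPotential
  have h6 : (1 : ℝ) ≤ 6 ^ G.span := one_le_pow₀ (by norm_num)
  rw [potential_zero, max_eq_right (by linarith), Real.log_mul (by norm_num) (by positivity),
    Real.log_pow]
  have h1 := Real.log_le_sub_one_of_pos (show (0 : ℝ) < 2 by norm_num)
  have h2 := Real.log_le_sub_one_of_pos (show (0 : ℝ) < 6 by norm_num)
  have h3 : (0 : ℝ) ≤ G.span := Nat.cast_nonneg _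
  nlinarith

/-! ### Expected numbers of steal attempts and deviations. -/

section Expectation

open MeasureTheory ProbabilityTheory

variable {Ω : Type*} [MeasurableSpace Ω] {μ : Measure Ω} [IsProbabilityMeasure μ]
  {X : ℕ → Ω → Fin P}

/-- The expected number of steal attempts before the end of the execution is at most proportional to
the number of processors times the span. -/
theorem lintegral_liveAttempt_le (hG : G.IsSuperFinalSingleTouch) {b : ℕ}
    (hσ : G.YieldFair b p₀ σ) (hX : ∀ n, Measurable (X n)) (hind : iIndepFun X μ)
    (hunif : ∀ n q, μ (X n ⁻¹' {q}) = (P : ℝ≥0∞)⁻¹) :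
    ∫⁻ ω, ∑' n, G.liveAttempt p₀ σ n (fun k => X k ω) ∂μ ≤
      3 * (b + 1) * P * (1 + 5 * G.span) := by
  set c : ℝ≥0∞ := 3 * (b + 1) * P with hc
  have hP : (P : ℝ≥0∞) ≠ 0 := by exact_mod_cast p₀.pos.ne'
  have hc0 : c ≠ 0 := by simp [hc, hP]
  have hct : c ≠ ⊤ := by
    have : c = ((3 * (b + 1) * P : ℕ) : ℝ≥0∞) := by push_cast; rfl
    rw [this]; exact ENNReal.natCast_ne_top _
  have h := lintegral_tsum_le_of_drift p₀ hX hind hunif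
    (Y := fun n x => ENNReal.ofReal (G.logPotential b p₀ σ n x))
    (a := fun n x => c⁻¹ * G.liveAttempt p₀ σ n x)
    (fun n x y h => by simp only [logPotential, potential_congr h])
    (fun n x y h => by simp only [dependsOnInitial_liveAttempt n x y h])
    (logPotential_drift hG hσ) (y₀ := 1 + 5 * G.span) (fun x => by
      refine (ENNReal.ofReal_le_ofReal (logPotential_zero_le b x)).trans (le_of_eq ?_)
      rw [ENNReal.ofReal_add (by norm_num) (by positivity), ENNReal.ofReal_mul (by norm_num)]
      simp)
  simp_rw [ENNReal.tsum_mul_left] at h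
  rw [lintegral_const_mul' _ _ (ENNReal.inv_ne_top.2 hc0)] at h
  calc _ = c * (c⁻¹ * ∫⁻ ω, ∑' n, G.liveAttempt p₀ σ n (fun k => X k ω) ∂μ) := by
        rw [← mul_assoc, ENNReal.mul_inv_cancel hc0 hct, one_mul]
    _ ≤ _ := by gcongr

theorem deviations_le (hG : G.IsSuperFinalSingleTouch) (x : ℕ → Fin P) :
    G.deviations p₀ σ x ≤ 4 * G.span * ∑' n, G.liveAttempt p₀ σ n x := by
  refine iSup_le fun n => ?_
  calc _ ≤ ((4 * G.span * (G.stolen p₀ σ x n).length : ℕ) : ℝ≥0∞) := by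
        exact_mod_cast ncard_deviation_le hG n
    _ ≤ _ := by
        push_cast
        gcongr
        exact (length_stolen_le x n).trans (ENNReal.sum_le_tsum _)

theorem lintegral_deviations_le (hG : G.IsSuperFinalSingleTouch) {b : ℕ}
    (hσ : G.YieldFair b p₀ σ) (hX : ∀ n, Measurable (X n)) (hind : iIndepFun X μ)
    (hunif : ∀ n q, μ (X n ⁻¹' {q}) = (P : ℝ≥0∞)⁻¹) :
    ∫⁻ ω, G.deviations p₀ σ (fun n => X n ω) ∂μ ≤
      ((72 * (b + 1) : ℕ) : ℝ≥0∞) * P * G.span ^ 2 := by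
  have htop : (4 * G.span : ℝ≥0∞) ≠ ⊤ := by
    have : (4 * G.span : ℝ≥0∞) = ((4 * G.span : ℕ) : ℝ≥0∞) := by push_cast; rfl
    rw [this]; exact ENNReal.natCast_ne_top _
  calc _ ≤ ∫⁻ ω, 4 * G.span * ∑' n, G.liveAttempt p₀ σ n (fun k => X k ω) ∂μ :=
        lintegral_mono fun ω => deviations_le hG _
    _ ≤ 4 * G.span * (3 * (b + 1) * P * (1 + 5 * G.span)) := by
        rw [lintegral_const_mul' _ _ htop]
        gcongr
        exact lintegral_liveAttempt_le hG hσ hX hind hunif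
    _ = ((4 * G.span * (3 * (b + 1) * P * (1 + 5 * G.span)) : ℕ) : ℝ≥0∞) := by push_cast; rfl
    _ ≤ ((72 * (b + 1) * P * G.span ^ 2 : ℕ) : ℝ≥0∞) := by
        refine Nat.cast_le.2 ?_
        -- With span 0 both sides vanish. Otherwise `1 + 5 * span ≤ 6 * span`, and `4 * 3 * 6 = 72`.
        rcases Nat.eq_zero_or_pos G.span with h | h
        · simp [h]
        · calc 4 * G.span * (3 * (b + 1) * P * (1 + 5 * G.span))
              ≤ 4 * G.span * (3 * (b + 1) * P * (G.span + 5 * G.span)) := by gcongr; exact h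
            _ = _ := by ring
    _ = _ := by push_cast; rfl

end Expectation

end FutureDag

theorem mainTheorem5 (b : ℕ) :
    ∃ K : ℕ, ∀ (V : Type*) [Fintype V] (G : FutureDag V), G.IsSuperFinalSingleTouch →
      ∀ (P : ℕ) (p₀ : Fin P) (σ : Adversary P), G.YieldFair b p₀ σ →
      ∀ (Ω : Type*) [MeasurableSpace Ω] (μ : MeasureTheory.Measure Ω)
        [MeasureTheory.IsProbabilityMeasure μ] (X : ℕ → Ω → Fin P),
        (∀ n, Measurable (X n)) → ProbabilityTheory.iIndepFun X μ →
        (∀ n q, μ (X n ⁻¹' {q}) = (P : ℝ≥0∞)⁻¹) →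
        (∫⁻ ω, G.deviations p₀ σ (fun n => X n ω) ∂μ ≤ K * P * G.span ^ 2) ∧
        ∀ (B : Type*) (acc : V → List B) (C : ℕ),
          ∫⁻ ω, (G.misses C acc p₀ σ (fun n => X n ω) - G.seqMisses C acc) ∂μ
            ≤ K * C * P * G.span ^ 2 := by
  refine ⟨72 * (b + 1), fun V _ G hG P p₀ σ hσ Ω _ μ _ X hX hind hunif => ?_⟩
  have h := FutureDag.lintegral_deviations_le hG hσ hX hind hunif
  refine ⟨h, fun B acc C => ?_⟩
  calc _ ≤ ∫⁻ ω, C * G.deviations p₀ σ (fun n => X n ω) ∂μ :=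
        MeasureTheory.lintegral_mono fun ω => FutureDag.misses_sub_le hG C acc
    _ = C * ∫⁻ ω, G.deviations p₀ σ (fun n => X n ω) ∂μ :=
        MeasureTheory.lintegral_const_mul' _ _ (ENNReal.natCast_ne_top C)
    _ ≤ C * (((72 * (b + 1) : ℕ) : ℝ≥0∞) * P * G.span ^ 2) := by gcongr
    _ = _ := by ring
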